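/- Let $H>0$ and let $(Y_t)_{t\ge 0}$ be a real-valued process with càdlàg paths which is $H$-self-similar, i.e. for every $c>0$ the processes $(Y_{ct})_{t\ge0}$ and $(c^HY_t)_{t\ge0}$ have the same finite-dimensional distributions, and suppose that $Y_1$ is standard normal. Let $T\ge 0$ be a random time independent of $Y$ with density $f_T$ on $(0,\infty)$. Let $0\le a<b$ and $\beta\in(0,\pi)$, put $S_\beta=\{z\in\mathbb C\setminus\{0\}: |\arg z|\le\beta\}$, and suppose that $f_T\in\mathcal C(\beta,a,b)$, which means that $\int_0^\infty f_T(x)x^{c-1}\,dx<\infty$ for all $c\in(a,b)$ and that there is a function $\tilde f$, holomorphic on (a neighbourhood of) $S_\beta$, with $\tilde f=f_T$ on $(0,\infty)$, $\tilde f(z)=\mathcal O(|z|^{-a})$ as $z\to0$ in $S_\beta$ and $\tilde f(z)=\mathcal O(|z|^{-b})$ as $|z|\to\infty$ in $S_\beta$. Let $X_1,X_2,\dots$ be i.i.d. with the law of $Y_T$. For $\gamma\in\mathbb R$ and a real sequence $(g_n)$ put, for $x>0$, $$\hat f_n(x)=\frac1{2\pi}\int_{-g_n}^{g_n}\frac{\frac1n\sum_{k=1}^n|X_k|^{(\gamma-1+iv)/H}}{\mathcal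 M\!\left(\frac{\gamma+H-1+iv}{H}\right)}\,x^{-\gamma-iv}\,dv,\qquad \mathcal M(s)=\mathbb E\big[|Y_1|^{s-1}\big].$$ Suppose that $\gamma\in\left(\max\{a,1-\tfrac H2\},b\right)$ and $2\gamma-1\in(a,b)$. Then there is a constant $C>0$, independent of $x$, of $n$ and of the sequence $(g_n)$, such that for every sequence $g_n\to\infty$, all sufficiently large $n$ and all $x>0$, $$x^{2\gamma}\,\mathbb E\big[|f_T(x)-\hat f_n(x)|^2\big]\le C\cdot\begin{cases}\frac1n e^{\pi g_n/(2H)}+e^{-2\beta g_n},&\gamma\ge1,\\[2pt] \frac1n g_n^{(1-\gamma)/H}e^{\pi g_n/(2H)}+e^{-2\beta g_n},&\gamma<1.\end{cases}$$ Moreover, with the choice $$g_n=\begin{cases}\dfrac{2H\log n}{\pi+4H\beta},&\gamma\ge1,\\[6pt] \dfrac{2H\log n-2(1-\gamma)\log\log n}{\pi+4H\beta},&\gamma<1,\end{cases}$$ one has, as $n\to\infty$, $$\sup_{x>0}\Big\{x^\gamma\sqrt{\mathbb E\big[|f_T(x)-\hat f_n(x)|^2\big]}\Big\}=\begin{cases}\mathcal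 O\big(n^{-2H\beta/(\pi+4H\beta)}\big),&\gamma\ge1,\\[2pt] \mathcal O\big(n^{-2H\beta/(\pi+4H\beta)}(\log n)^{2\beta(1-\gamma)/(\pi+4H\beta)}\big),&\gamma<1.\end{cases}$$ -/

import Mathlib

open MeasureTheory ProbabilityTheory Filter Topology Set
open scoped NNReal ENNReal

noncomputable section

/-- A path `[0, ∞) → ℝ` is càdlàg: right-continuous everywhere, with finite left limits. -/
def IsCadlag (y : ℝ≥0 → ℝ) : Prop :=
  ∀ t : ℝ≥0, ContinuousWithinAt y (Ici t) t ∧ ∃ l : ℝ, Tendsto y (𝓝[<] t) (𝓝 l)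

/-- `Y` is `H`-self-similar: for every `c > 0` the processes `(Y_{ct})_t` and `(c^H Y_t)_t` have
the same finite-dimensional distributions. -/
def IsSelfSimilar {Ω : Type*} [MeasurableSpace Ω] (P : Measure Ω) (H : ℝ)
    (Y : ℝ≥0 → Ω → ℝ) : Prop :=
  ∀ c : ℝ≥0, 0 < c → ∀ I : Finset ℝ≥0,
    P.map (fun ω (i : I) => Y (c * i) ω) = P.map (fun ω (i : I) => (c : ℝ) ^ H * Y i ω)

/-- `f` is a probability density, with respect to Lebesgue measure on `(0, ∞)`, of the law of the
nonnegative random variable `T`. -/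
def HasDensity {Ω : Type*} [MeasurableSpace Ω] (P : Measure Ω) (T : Ω → ℝ≥0)
    (f : ℝ → ℝ) : Prop :=
  (∀ x : ℝ, 0 < x → 0 ≤ f x) ∧
    P.map (fun ω => (T ω : ℝ)) =
      (volume.restrict (Ioi (0 : ℝ))).withDensity (fun x => ENNReal.ofReal (f x))

/-- The class `𝔐_{(a,b)}`: `∫₀^∞ |f(x)| x^{c-1} dx < ∞` for all `c ∈ (a, b)`. -/
def MellinClass (a b : ℝ) (f : ℝ → ℝ) : Prop :=
  ∀ c ∈ Ioo a b, IntegrableOn (fun x : ℝ => f x * x ^ (c - 1)) (Ioi 0)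

/-- The closed sector `{z : |arg z| ≤ β}` without its vertex. -/
def sector (β : ℝ) : Set ℂ := {z | z ≠ 0 ∧ |z.arg| ≤ β}

/-- The class `C(β, a, b)`. -/
def ClassC (β a b : ℝ) (f : ℝ → ℝ) : Prop :=
  MellinClass a b f ∧
    ∃ F : ℂ → ℂ, AnalyticOnNhd ℂ F (sector β) ∧
      (∀ x : ℝ, 0 < x → F (x : ℂ) = (f x : ℂ)) ∧
      F =O[𝓝 0 ⊓ 𝓟 (sector β)] (fun z => ‖z‖ ^ (-a)) ∧
      F =O[Bornology.cobounded ℂ ⊓ 𝓟 (sector β)] (fun z => ‖z‖ ^ (-b))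

/-- The Mellin transform of the random variable `|Z|`, that is `s ↦ E[|Z|^{s-1}]`. -/
def absMellin {Ω : Type*} [MeasurableSpace Ω] (P : Measure Ω) (Z : Ω → ℝ) (s : ℂ) : ℂ :=
  ∫ ω, ((|Z ω| : ℝ) : ℂ) ^ (s - 1) ∂P

/-- The empirical Mellin transform of `|x_0|, …, |x_{n-1}|`. -/
def empMellin (n : ℕ) (x : ℕ → ℝ) (s : ℂ) : ℂ :=
  (1 / (n : ℂ)) * ∑ k ∈ Finset.range n, ((|x k| : ℝ) : ℂ) ^ (s - 1)

/-- The estimator with cut-off `g`, for the Mellin transform `M` of `|Y_1|` and the observations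
`obs 0, …, obs (n-1)`. -/
def estimator (H γ : ℝ) (M : ℂ → ℂ) (g : ℝ) (n : ℕ) (obs : ℕ → ℝ) (x : ℝ) : ℂ :=
  (1 / (2 * (Real.pi : ℂ))) * ∫ v in (-g)..g,
    empMellin n obs (((γ : ℂ) + H - 1 + v * Complex.I) / H) /
      M (((γ : ℂ) + H - 1 + v * Complex.I) / H) * (x : ℂ) ^ (-(γ : ℂ) - v * Complex.I)

/-- The mean squared error `E[|θ - θ̂|²]`, as an extended nonnegative number. -/
def mse {Ω : Type*} [MeasurableSpace Ω] (P : Measure Ω) (θ : ℝ) (est : Ω → ℂ) : ℝ≥0∞ :=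
  ∫⁻ ω, ‖(θ : ℂ) - est ω‖ₑ ^ 2 ∂P

/-- The bound on the weighted mean squared error for cut-off `g` and sample size `n`. -/
def mseBound (H γ β g : ℝ) (n : ℕ) : ℝ :=
  if 1 ≤ γ then
    1 / n * Real.exp (Real.pi * g / (2 * H)) + Real.exp (-2 * β * g)
  else
    1 / n * g ^ ((1 - γ) / H) * Real.exp (Real.pi * g / (2 * H)) + Real.exp (-2 * β * g)

/-- The cut-off `g_n`. -/
def cutoff (H γ β : ℝ) (n : ℕ) : ℝ :=
  if 1 ≤ γ then
    2 * H * Real.log n / (Real.pi + 4 * H * β)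
  else
    (2 * H * Real.log n - 2 * (1 - γ) * Real.log (Real.log n)) / (Real.pi + 4 * H * β)

/-- The convergence rate. -/
def rate (H γ β : ℝ) (n : ℕ) : ℝ :=
  if 1 ≤ γ then
    (n : ℝ) ^ (-(2 * H * β / (Real.pi + 4 * H * β)))
  else
    (n : ℝ) ^ (-(2 * H * β / (Real.pi + 4 * H * β))) *
      Real.log n ^ ((1 - γ) * (2 * β) / (Real.pi + 4 * H * β))

end

/-! Self-similarity and independence give `Y_T` the law of `T ^ H * Y_1`. Absolute moments therefore
factor: the moment of order `(γ - 1 + iv) / H` is the Mellin transform of the density at `γ + iv`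
times the Gaussian factor `M`. Dividing empirical moments by `M` thus estimates the Mellin transform
without bias, and the estimator is its truncated Mellin inversion.

Bias. After `x = exp u` the Mellin transform is an integral over the real line, and holomorphy in
the sector allows the line to be shifted by `±β`. This gives decay `exp (-β |v|)`, so the
frequencies lost to truncation contribute `x ^ (-γ) * exp (-β g)` (`exists_norm_mellin_le`,
`exists_norm_sub_truncated_mellinInv_le`).

Variance. The estimator is a sample mean of i.i.d. kernels bounded by `x ^ (-γ) |X_k| ^ ((γ - 1) /
H)` times the integral of `1 / |M|` over `[-g, g]`. The second moment is finite because `2γ - 1 ∈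
(a, b)` and `γ > 1 - H / 2`. Up to elementary factors `M` is `Γ` on the line of abscissa `σ = (γ + H
- 1) / (2H)`, so a lower bound of order `|t| ^ (-max 0 (1/2 - σ)) * exp (-π |t| / 2)` is needed
(`exists_norm_Gamma_ge`). It is obtained without Stirling's formula: in Euler's limit, `|Γ(σ + it)|
/ Γ(σ)` is increasing and log-concave in `σ`, and it is explicit at `1/2`, `1` and `3/2`.

Both errors carry `x ^ (-γ)`, whence uniformity in `x`; the cut-off balances them. -/

/-! ### Lower bounds for the Gamma function on vertical lines -/

section GammaBounds

theorem norm_ofReal_add_mul_I_pos {x : ℝ} (hx : 0 < x) (t : ℝ) :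
    0 < ‖(x : ℂ) + t * Complex.I‖ := by
  rw [norm_pos_iff]
  intro h
  have := congrArg Complex.re h
  simp at this
  exact hx.ne' this

theorem norm_ofReal_add_mul_I_sq (x t : ℝ) :
    ‖(x : ℂ) + t * Complex.I‖ ^ 2 = x ^ 2 + t ^ 2 := by
  rw [← Complex.normSq_eq_norm_sq]
  simp [Complex.normSq_apply]
  ring

/-- The modulus of `x / (x + i t)`. -/
noncomputable def cosArg (t x : ℝ) : ℝ := x / ‖(x : ℂ) + t * Complex.I‖

theorem cosArg_pos {x : ℝ} (hx : 0 < x) (t : ℝ) : 0 < cosArg t x :=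
  div_pos hx (norm_ofReal_add_mul_I_pos hx t)

theorem cosArg_mono {x y : ℝ} (hx : 0 < x) (hxy : x ≤ y) (t : ℝ) : cosArg t x ≤ cosArg t y := by
  have hy := hx.trans_le hxy
  unfold cosArg
  rw [div_le_div_iff₀ (norm_ofReal_add_mul_I_pos hx t) (norm_ofReal_add_mul_I_pos hy t)]
  refine le_of_sq_le_sq ?_ (by positivity)
  rw [mul_pow, mul_pow, norm_ofReal_add_mul_I_sq, norm_ofReal_add_mul_I_sq]
  have : x ^ 2 ≤ y ^ 2 := by gcongr
  nlinarith [mul_le_mul_of_nonneg_right this (sq_nonneg t)]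

theorem log_cosArg {x : ℝ} (hx : 0 < x) (t : ℝ) :
    Real.log (cosArg t x) = Real.log x - 2⁻¹ * Real.log (x ^ 2 + t ^ 2) := by
  rw [cosArg, Real.log_div hx.ne' (norm_ofReal_add_mul_I_pos hx t).ne',
    ← norm_ofReal_add_mul_I_sq, Real.log_pow]
  push_cast
  ring

theorem hasDerivAt_log_cosArg {x : ℝ} (hx : 0 < x) (t : ℝ) :
    HasDerivAt (fun x => Real.log x - 2⁻¹ * Real.log (x ^ 2 + t ^ 2))
      (t ^ 2 / (x * (x ^ 2 + t ^ 2))) x := by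
  have h1 : x ^ 2 + t ^ 2 ≠ 0 := by positivity
  have h2 : HasDerivAt (fun x : ℝ => x ^ 2 + t ^ 2) (2 * x) x := by
    simpa using (hasDerivAt_pow 2 x).add_const (t ^ 2)
  refine ((Real.hasDerivAt_log hx.ne').sub ((h2.log h1).const_mul 2⁻¹)).congr_deriv ?_
  field_simp
  ring

/-- The derivative `t² / (x (x² + t²))` decreases in `x > 0`. -/
theorem concaveOn_log_cosArg (t : ℝ) : ConcaveOn ℝ (Ioi 0) (fun x => Real.log (cosArg t x)) := by
  have key : ConcaveOn ℝ (Ioi 0) (fun x => Real.log x - 2⁻¹ * Real.log (x ^ 2 + t ^ 2)) := by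
    refine AntitoneOn.concaveOn_of_deriv (convex_Ioi 0)
      (fun x hx => (hasDerivAt_log_cosArg hx t).continuousAt.continuousWithinAt)
      (fun x hx => ?_) (fun x hx y hy hxy => ?_)
    · rw [interior_Ioi] at hx
      exact (hasDerivAt_log_cosArg hx t).differentiableAt.differentiableWithinAt
    · rw [interior_Ioi, mem_Ioi] at hx hy
      rw [(hasDerivAt_log_cosArg hx t).deriv, (hasDerivAt_log_cosArg hy t).deriv]
      gcongr
  exact key.congr fun x hx => (log_cosArg hx t).symm

theorem cosArg_interpolate {x y : ℝ} (hx : 0 < x) (hy : 0 < y) {p q : ℝ} (hp : 0 ≤ p) (hq : 0 ≤ q)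
    (hpq : p + q = 1) (t : ℝ) :
    cosArg t x ^ p * cosArg t y ^ q ≤ cosArg t (p * x + q * y) := by
  have hz : 0 < p * x + q * y := (convex_Ioi (0 : ℝ)) hx hy hp hq hpq
  have h := (concaveOn_log_cosArg t).2 hx hy hp hq hpq
  have hX := cosArg_pos hx t
  have hY := cosArg_pos hy t
  rw [← Real.log_le_log_iff (by positivity) (cosArg_pos hz t),
    Real.log_mul (by positivity) (by positivity), Real.log_rpow hX, Real.log_rpow hY]
  simpa using h

/-- In `n ^ s n! / ∏ (s + j)` the modulus of the numerator does not see `t`; only the factors `|σ +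
j + it|` differ from the real case. -/
theorem norm_GammaSeq (σ t : ℝ) (hσ : 0 < σ) (n : ℕ) (hn : n ≠ 0) :
    ‖Complex.GammaSeq (σ + t * Complex.I) n‖ =
      Real.GammaSeq σ n * ∏ j ∈ Finset.range (n + 1), cosArg t (σ + j) := by
  have hn' : (0 : ℝ) < n := by positivity
  unfold Complex.GammaSeq Real.GammaSeq cosArg
  rw [Finset.prod_div_distrib, norm_div, norm_mul, norm_prod, ← Complex.ofReal_natCast n,
    Complex.norm_cpow_eq_rpow_re_of_pos hn']
  have h0 : ∏ j ∈ Finset.range (n + 1), (σ + j) ≠ 0 :=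
    Finset.prod_ne_zero_iff.2 fun j _ => by positivity
  have h1 : ∀ j : ℕ, (σ : ℂ) + t * Complex.I + j = ((σ + j : ℝ) : ℂ) + t * Complex.I := by
    intro j
    push_cast
    ring
  simp only [h1, Complex.add_re, Complex.ofReal_re, Complex.mul_re, Complex.I_re, mul_zero,
    Complex.ofReal_im, Complex.I_im, mul_one, sub_self, add_zero, Complex.norm_natCast]
  field_simp

/-- The ratio `|Γ(σ + i t)| / Γ(σ)`. -/
noncomputable def gammaRatio (t σ : ℝ) : ℝ :=
  ‖Complex.Gamma (σ + t * Complex.I)‖ / Real.Gamma σ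

theorem tendsto_prod_cosArg (t : ℝ) {σ : ℝ} (hσ : 0 < σ) :
    Tendsto (fun n : ℕ => ∏ j ∈ Finset.range (n + 1), cosArg t (σ + j)) atTop
      (𝓝 (gammaRatio t σ)) := by
  have h := (Complex.GammaSeq_tendsto_Gamma (σ + t * Complex.I)).norm.div
    (Real.GammaSeq_tendsto_Gamma σ) (Real.Gamma_pos_of_pos hσ).ne'
  refine h.congr' ?_
  filter_upwards [eventually_ne_atTop 0] with n hn
  have hn' : (0 : ℝ) < n := by positivity
  have hpos : 0 < Real.GammaSeq σ n := by
    unfold Real.GammaSeq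
    have : 0 < ∏ j ∈ Finset.range (n + 1), (σ + j) := Finset.prod_pos fun j _ => by positivity
    positivity
  rw [Pi.div_apply, norm_GammaSeq σ t hσ n hn]
  field_simp

theorem gammaRatio_mono (t : ℝ) {x y : ℝ} (hx : 0 < x) (hxy : x ≤ y) :
    gammaRatio t x ≤ gammaRatio t y := by
  refine le_of_tendsto_of_tendsto' (tendsto_prod_cosArg t hx)
    (tendsto_prod_cosArg t (hx.trans_le hxy)) fun n => ?_
  refine Finset.prod_le_prod (fun j _ => (cosArg_pos (by positivity) t).le) fun j _ => ?_
  exact cosArg_mono (by positivity) (by linarith) t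

/-- Log-concavity of each factor survives products and limits. This supplies the fractional powers
of `|t|` between the lines where `Γ` is explicit. -/
theorem gammaRatio_interpolate (t : ℝ) {x y : ℝ} (hx : 0 < x) (hy : 0 < y) {p q : ℝ} (hp : 0 ≤ p)
    (hq : 0 ≤ q) (hpq : p + q = 1) :
    gammaRatio t x ^ p * gammaRatio t y ^ q ≤ gammaRatio t (p * x + q * y) := by
  have hz : 0 < p * x + q * y := (convex_Ioi (0 : ℝ)) hx hy hp hq hpq
  refine le_of_tendsto_of_tendsto'
    (((tendsto_prod_cosArg t hx).rpow_const (Or.inr hp)).mul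
      ((tendsto_prod_cosArg t hy).rpow_const (Or.inr hq))) (tendsto_prod_cosArg t hz) fun n => ?_
  rw [← Real.finsetProd_rpow _ _ fun j _ => (cosArg_pos (by positivity) t).le,
    ← Real.finsetProd_rpow _ _ fun j _ => (cosArg_pos (by positivity) t).le,
    ← Finset.prod_mul_distrib]
  refine Finset.prod_le_prod (fun j _ => ?_) fun j _ => ?_
  · have := cosArg_pos (show 0 < x + j by positivity) t
    have := cosArg_pos (show 0 < y + j by positivity) t
    positivity
  · refine (cosArg_interpolate (show 0 < x + j by positivity) (show 0 < y + j by positivity)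
      hp hq hpq t).trans_eq ?_
    congr 1
    linear_combination (j : ℝ) * hpq

/-- On the critical line `1 - s` is the conjugate of `s`, so the reflection formula reads `|Γ(s)|² =
π / cosh (π t)`. -/
theorem norm_Gamma_half (t : ℝ) :
    √Real.pi * Real.exp (-(Real.pi * |t| / 2)) ≤
      ‖Complex.Gamma (((1 / 2 : ℝ) : ℂ) + t * Complex.I)‖ := by
  have hpi := Real.pi_pos
  set s : ℂ := ((1 / 2 : ℝ) : ℂ) + t * Complex.I with hs
  have hconj : 1 - s = (starRingEnd ℂ) s := by
    apply Complex.ext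
    · simp [hs]
      norm_num
    · simp [hs]
  have hrefl := congrArg norm (Complex.Gamma_mul_Gamma_one_sub s)
  have hsin : Complex.sin (Real.pi * s) = ((Real.cosh (Real.pi * t) : ℝ) : ℂ) := by
    have : (Real.pi : ℂ) * s = ((Real.pi * t : ℝ) : ℂ) * Complex.I + Real.pi / 2 := by
      rw [hs]
      push_cast
      ring
    rw [this, Complex.sin_add_pi_div_two, Complex.cos_mul_I, Complex.ofReal_cosh]
  rw [hconj, Complex.Gamma_conj, norm_mul, RCLike.norm_conj, hsin, norm_div, Complex.norm_real,
    Complex.norm_real, Real.norm_of_nonneg hpi.le, Real.norm_of_nonneg (Real.cosh_pos _).le] at hrefl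
  refine le_of_sq_le_sq ?_ (norm_nonneg _)
  rw [mul_pow, Real.sq_sqrt hpi.le, ← Real.exp_nat_mul, sq ‖_‖, hrefl, le_div_iff₀ (Real.cosh_pos _),
    mul_assoc]
  have h1 : Real.cosh (Real.pi * t) ≤ Real.exp (Real.pi * |t|) := by
    rw [← Real.cosh_abs, Real.cosh_eq, abs_mul, abs_of_pos hpi]
    have : Real.exp (-(Real.pi * |t|)) ≤ Real.exp (Real.pi * |t|) :=
      Real.exp_le_exp.2 (by nlinarith [abs_nonneg t])
    linarith
  have h2 : Real.exp ((2 : ℕ) * -(Real.pi * |t| / 2)) * Real.cosh (Real.pi * t) ≤ 1 := by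
    refine (mul_le_mul_of_nonneg_left h1 (Real.exp_nonneg _)).trans_eq ?_
    rw [← Real.exp_add, Real.exp_eq_one_iff]
    push_cast
    ring
  nlinarith

/-- Reflection at `s = it`, where `1 - s` is the conjugate of `s + 1`, combined with `Γ(s + 1) = s
Γ(s)`, gives `|Γ(1 + it)|² = π |t| / sinh (π |t|)` for `t ≠ 0`. -/
theorem norm_Gamma_one (t : ℝ) :
    √(2 * Real.pi * |t|) * Real.exp (-(Real.pi * |t| / 2)) ≤
      ‖Complex.Gamma (((1 : ℝ) : ℂ) + t * Complex.I)‖ := by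
  have hpi := Real.pi_pos
  rcases eq_or_ne t 0 with rfl | ht
  · simp
  have ht' : 0 < |t| := abs_pos.2 ht
  have hs0 : (t : ℂ) * Complex.I ≠ 0 := by simp [ht]
  set s : ℂ := t * Complex.I with hs
  have hconj : 1 - s = (starRingEnd ℂ) (s + 1) := by
    apply Complex.ext <;> simp [hs]
  have hrefl := congrArg norm (Complex.Gamma_mul_Gamma_one_sub s)
  have hG := congrArg norm (Complex.Gamma_add_one s hs0)
  have hsin : Complex.sin (Real.pi * s) = ((Real.sinh (Real.pi * t) : ℝ) : ℂ) * Complex.I := by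
    have : (Real.pi : ℂ) * s = ((Real.pi * t : ℝ) : ℂ) * Complex.I := by
      rw [hs]
      push_cast
      ring
    rw [this, Complex.sin_mul_I, Complex.ofReal_sinh]
  rw [norm_mul, show ‖s‖ = |t| by simp [hs]] at hG
  rw [hconj, Complex.Gamma_conj, norm_mul, RCLike.norm_conj, hsin, norm_div, norm_mul,
    Complex.norm_I, Complex.norm_real, Complex.norm_real, Real.norm_of_nonneg hpi.le, mul_one,
    Real.norm_eq_abs, Real.abs_sinh, abs_mul, abs_of_pos hpi] at hrefl
  have hsh : 0 < Real.sinh (Real.pi * |t|) := Real.sinh_pos_iff.2 (by positivity)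
  have h3 : ‖Complex.Gamma (s + 1)‖ * ‖Complex.Gamma (s + 1)‖ =
      |t| * (Real.pi / Real.sinh (Real.pi * |t|)) := by
    rw [← hrefl, ← mul_assoc, ← hG]
  rw [show ((1 : ℝ) : ℂ) + s = s + 1 by push_cast; ring]
  refine le_of_sq_le_sq ?_ (norm_nonneg _)
  rw [mul_pow, Real.sq_sqrt (by positivity), ← Real.exp_nat_mul, sq ‖_‖, h3, ← mul_div_assoc,
    le_div_iff₀ hsh]
  have h1 : Real.sinh (Real.pi * |t|) ≤ Real.exp (Real.pi * |t|) / 2 := by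
    rw [Real.sinh_eq]
    have := Real.exp_nonneg (-(Real.pi * |t|))
    linarith
  have h2 : Real.exp ((2 : ℕ) * -(Real.pi * |t| / 2)) * Real.sinh (Real.pi * |t|) ≤ 1 / 2 := by
    refine (mul_le_mul_of_nonneg_left h1 (Real.exp_nonneg _)).trans_eq ?_
    rw [← mul_div_assoc, ← Real.exp_add]
    congr 1
    rw [Real.exp_eq_one_iff]
    push_cast
    ring
  have h4 : 0 < Real.pi * |t| := by positivity
  nlinarith

theorem gammaRatio_half_ge (t : ℝ) : Real.exp (-(Real.pi * |t| / 2)) ≤ gammaRatio t (1 / 2) := by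
  have h := norm_Gamma_half t
  rw [gammaRatio, Real.Gamma_one_half_eq, le_div_iff₀ (by positivity)]
  linarith

theorem gammaRatio_one_ge (t : ℝ) :
    |t| ^ (1 / 2 : ℝ) * Real.exp (-(Real.pi * |t| / 2)) ≤ gammaRatio t 1 := by
  have h := norm_Gamma_one t
  rw [gammaRatio, Real.Gamma_one, div_one, ← Real.sqrt_eq_rpow]
  refine le_trans ?_ h
  gcongr
  nlinarith [abs_nonneg t, Real.pi_gt_three]

theorem gammaRatio_three_half_ge (t : ℝ) :
    |t| * Real.exp (-(Real.pi * |t| / 2)) ≤ gammaRatio t (3 / 2) := by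
  have h := norm_Gamma_half t
  have hne : ((1 / 2 : ℝ) : ℂ) + t * Complex.I ≠ 0 :=
    norm_pos_iff.1 (norm_ofReal_add_mul_I_pos (by norm_num) t)
  have h1 : Complex.Gamma (((3 / 2 : ℝ) : ℂ) + t * Complex.I) =
      (((1 / 2 : ℝ) : ℂ) + t * Complex.I) * Complex.Gamma (((1 / 2 : ℝ) : ℂ) + t * Complex.I) := by
    rw [← Complex.Gamma_add_one _ hne]
    congr 1
    push_cast
    ring
  have h2 : Real.Gamma (3 / 2) = 1 / 2 * √Real.pi := by
    rw [← Real.Gamma_one_half_eq, ← Real.Gamma_add_one (by norm_num)]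
    norm_num
  have h3 : |t| ≤ ‖((1 / 2 : ℝ) : ℂ) + t * Complex.I‖ := by
    simpa using Complex.abs_im_le_norm (((1 / 2 : ℝ) : ℂ) + t * Complex.I)
  have hpos : 0 < √Real.pi := Real.sqrt_pos.2 Real.pi_pos
  rw [gammaRatio, h1, h2, le_div_iff₀ (by positivity), norm_mul]
  calc |t| * Real.exp (-(Real.pi * |t| / 2)) * (1 / 2 * √Real.pi)
      = 1 / 2 * (|t| * (√Real.pi * Real.exp (-(Real.pi * |t| / 2)))) := by ring
    _ ≤ 1 * (|t| * (√Real.pi * Real.exp (-(Real.pi * |t| / 2)))) := by gcongr; norm_num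
    _ = |t| * (√Real.pi * Real.exp (-(Real.pi * |t| / 2))) := one_mul _
    _ ≤ _ := by gcongr

theorem norm_Gamma_ge_of_half_le {σ : ℝ} (hσ : 1 / 2 ≤ σ) (t : ℝ) :
    Real.Gamma σ * Real.exp (-(Real.pi * |t| / 2)) ≤ ‖Complex.Gamma (σ + t * Complex.I)‖ := by
  have hG : 0 < Real.Gamma σ := Real.Gamma_pos_of_pos (by linarith)
  have h := (gammaRatio_half_ge t).trans (gammaRatio_mono t (by norm_num) hσ)
  rw [gammaRatio, le_div_iff₀ hG] at h
  linarith

/-- Monotonicity from `1/2` is unavailable here. Instead `1 + σ` lies between `1` and `3/2`;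
interpolation gives the power `|t| ^ (1/2 + σ)` there, and one step of the recurrence divides by `|σ
+ it| ≤ 2 |t|`. -/
theorem norm_Gamma_ge_of_lt_half {σ : ℝ} (hσ : 0 < σ) (hσ' : σ < 1 / 2) {t : ℝ} (ht : 1 ≤ |t|) :
    Real.Gamma (1 + σ) / 2 * (1 + |t|) ^ (-(1 / 2 - σ)) * Real.exp (-(Real.pi * |t| / 2)) ≤
      ‖Complex.Gamma (σ + t * Complex.I)‖ := by
  have hG : 0 < Real.Gamma (1 + σ) := Real.Gamma_pos_of_pos (by linarith)
  have ht0 : 0 < |t| := by linarith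
  set e := Real.exp (-(Real.pi * |t| / 2)) with he
  have hepos : 0 < e := Real.exp_pos _
  have h := gammaRatio_interpolate t (x := 1) (y := 3 / 2) (p := 1 - 2 * σ) (q := 2 * σ)
    (by norm_num) (by norm_num) (by linarith) (by linarith) (by ring)
  have h1 : |t| ^ (1 / 2 + σ) * e ≤ gammaRatio t (1 + σ) := by
    rw [show (1 - 2 * σ) * 1 + 2 * σ * (3 / 2) = 1 + σ by ring] at h
    refine le_trans ?_ h
    calc |t| ^ (1 / 2 + σ) * e
        = (|t| ^ (1 / 2 : ℝ) * e) ^ (1 - 2 * σ) * (|t| * e) ^ (2 * σ) := by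
          rw [Real.mul_rpow (by positivity) hepos.le, Real.mul_rpow (by positivity) hepos.le,
            ← Real.rpow_mul ht0.le]
          calc |t| ^ (1 / 2 + σ) * e = |t| ^ (1 / 2 * (1 - 2 * σ) + 2 * σ) *
                e ^ ((1 - 2 * σ) + 2 * σ) := by
                rw [show (1 - 2 * σ) + 2 * σ = 1 by ring, Real.rpow_one]
                congr 2
                ring
            _ = _ := by
                rw [Real.rpow_add ht0, Real.rpow_add hepos]
                ring
      _ ≤ _ := by
          have h0 : 0 ≤ gammaRatio t 1 :=
            div_nonneg (norm_nonneg _) (Real.Gamma_pos_of_pos one_pos).le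
          gcongr
          · linarith
          · exact gammaRatio_one_ge t
          · exact gammaRatio_three_half_ge t
  have hne : (σ : ℂ) + t * Complex.I ≠ 0 :=
    norm_pos_iff.1 (norm_ofReal_add_mul_I_pos hσ t)
  have h2 : ‖Complex.Gamma (((1 + σ : ℝ) : ℂ) + t * Complex.I)‖ =
      ‖(σ : ℂ) + t * Complex.I‖ * ‖Complex.Gamma (σ + t * Complex.I)‖ := by
    rw [← norm_mul, ← Complex.Gamma_add_one _ hne]
    congr 2
    push_cast
    ring
  have h3 : ‖(σ : ℂ) + t * Complex.I‖ ≤ 2 * |t| := by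
    refine (norm_add_le _ _).trans ?_
    simp only [Complex.norm_real, norm_mul, Complex.norm_I, mul_one, Real.norm_eq_abs,
      abs_of_pos hσ]
    linarith
  rw [gammaRatio, le_div_iff₀ hG, h2] at h1
  have h4 : |t| ^ (1 / 2 + σ) * e * Real.Gamma (1 + σ) ≤
      2 * |t| * ‖Complex.Gamma (σ + t * Complex.I)‖ :=
    h1.trans (by gcongr)
  have h5 : (1 + |t|) ^ (-(1 / 2 - σ)) ≤ |t| ^ (-(1 / 2 - σ)) :=
    Real.rpow_le_rpow_of_nonpos ht0 (by linarith) (by linarith)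
  have h6 : |t| ^ (1 / 2 + σ) = |t| * |t| ^ (-(1 / 2 - σ)) := by
    rw [← Real.rpow_one_add' ht0.le (by linarith)]
    congr 1
    ring
  rw [h6] at h4
  have h7 : |t| ^ (-(1 / 2 - σ)) * e * Real.Gamma (1 + σ) ≤
      2 * ‖Complex.Gamma (σ + t * Complex.I)‖ := by
    refine le_of_mul_le_mul_left ?_ ht0
    linarith
  calc Real.Gamma (1 + σ) / 2 * (1 + |t|) ^ (-(1 / 2 - σ)) * e
      ≤ Real.Gamma (1 + σ) / 2 * |t| ^ (-(1 / 2 - σ)) * e := by gcongr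
    _ ≤ _ := by linarith

/-- Lower bound for the Gamma function on a vertical line, of the exact order given by Stirling's
formula when `σ ≤ 1 / 2`. -/
theorem exists_norm_Gamma_ge {σ : ℝ} (hσ : 0 < σ) :
    ∃ c : ℝ, 0 < c ∧ ∀ t : ℝ,
      c * (1 + |t|) ^ (-(max 0 (1 / 2 - σ))) * Real.exp (-(Real.pi * |t| / 2)) ≤
        ‖Complex.Gamma (σ + t * Complex.I)‖ := by
  rcases le_or_gt (1 / 2) σ with h | h
  · refine ⟨Real.Gamma σ, Real.Gamma_pos_of_pos hσ, fun t => ?_⟩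
    rw [max_eq_left (by linarith), neg_zero, Real.rpow_zero, mul_one]
    exact norm_Gamma_ge_of_half_le h t
  · rw [max_eq_right (by linarith)]
    have hcont : ContinuousOn (fun t : ℝ => ‖Complex.Gamma (σ + t * Complex.I)‖) (Icc (-1) 1) := by
      refine ContinuousOn.norm fun t _ => ContinuousAt.continuousWithinAt ?_
      refine ContinuousAt.comp (f := fun t : ℝ => (σ : ℂ) + t * Complex.I)
        (Complex.differentiableAt_Gamma _ fun m hm => ?_).continuousAt (by fun_prop)
      have := congrArg Complex.re hm
      simp at this
      have : (0 : ℝ) ≤ m := m.cast_nonneg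
      linarith
    -- For `|t| ≤ 1` the continuous, nonvanishing modulus has a positive minimum; the other factors
    -- of the claimed bound are at most `1`.
    obtain ⟨t₀, -, ht₀⟩ := isCompact_Icc.exists_isMinOn (nonempty_Icc.2 (by norm_num)) hcont
    have hpos : 0 < ‖Complex.Gamma (σ + t₀ * Complex.I)‖ :=
      norm_pos_iff.2 (Complex.Gamma_ne_zero_of_re_pos (by simpa using hσ))
    have hG : 0 < Real.Gamma (1 + σ) := Real.Gamma_pos_of_pos (by linarith)
    refine ⟨min (Real.Gamma (1 + σ) / 2) ‖Complex.Gamma (σ + t₀ * Complex.I)‖,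
      by positivity, fun t => ?_⟩
    rcases le_or_gt 1 |t| with ht | ht
    · refine le_trans ?_ (norm_Gamma_ge_of_lt_half hσ h ht)
      gcongr
      exact min_le_left _ _
    · have h1 : (1 + |t|) ^ (-(1 / 2 - σ)) ≤ 1 :=
        Real.rpow_le_one_of_one_le_of_nonpos (by linarith [abs_nonneg t]) (by linarith)
      have h2 : Real.exp (-(Real.pi * |t| / 2)) ≤ 1 :=
        Real.exp_le_one_iff.2 (by have := Real.pi_pos; have := abs_nonneg t; nlinarith)
      have h3 := ht₀ (abs_le.1 ht.le)
      simp only [Set.mem_ofPred_eq] at h3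
      calc _ ≤ ‖Complex.Gamma (σ + t₀ * Complex.I)‖ * 1 * 1 := by
            gcongr
            exact min_le_right _ _
        _ ≤ _ := by simpa using h3

end GammaBounds

/-! ### The Mellin transform of a standard normal modulus and its reciprocal -/

section GaussianMoments

theorem MeasureTheory.IntegrableOn.integrable_comp_abs {E : Type*} [NormedAddCommGroup E]
    {f : ℝ → E} (hf : IntegrableOn f (Ioi 0)) : Integrable (fun x => f |x|) := by
  have hpos : IntegrableOn (fun x => f |x|) (Ioi 0) :=
    hf.congr_fun (fun x hx => by rw [abs_of_pos hx]) measurableSet_Ioi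
  have hneg : IntegrableOn (fun x => f |x|) (Iic 0) := by
    rw [← Measure.map_neg_eq_self (volume : Measure ℝ)]
    let m : MeasurableEmbedding fun x : ℝ => -x := (Homeomorph.neg ℝ).measurableEmbedding
    rw [m.integrableOn_map_iff]
    simp_rw [Function.comp_def, abs_neg, neg_preimage, neg_Iic, neg_zero]
    exact (integrableOn_Ici_iff_integrableOn_Ioi (by simp)).2 hpos
  rw [← integrableOn_univ, ← Iic_union_Ioi (a := (0 : ℝ))]
  exact hneg.union hpos

theorem integral_comp_abs_of_integrableOn {E : Type*} [NormedAddCommGroup E] [NormedSpace ℝ E]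
    {f : ℝ → E} (hf : IntegrableOn f (Ioi 0)) :
    ∫ x, f |x| = (2 : ℝ) • ∫ x in Ioi (0 : ℝ), f x := by
  have h := hf.integrable_comp_abs
  have hpos : ∫ x in Ioi (0 : ℝ), f |x| = ∫ x in Ioi (0 : ℝ), f x :=
    setIntegral_congr_fun measurableSet_Ioi fun x hx => by
      simp only [abs_of_pos (mem_Ioi.1 hx)]
  have hneg : ∫ x in Iic (0 : ℝ), f |x| = ∫ x in Ioi (0 : ℝ), f x := by
    rw [← neg_zero, ← integral_comp_neg_Iic, neg_zero]
    exact setIntegral_congr_fun measurableSet_Iic fun x hx => by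
      simp only [abs_of_nonpos (mem_Iic.1 hx)]
  rw [two_smul, ← setIntegral_univ, ← Iic_union_Ioi (a := (0 : ℝ)),
    setIntegral_union (Iic_disjoint_Ioi le_rfl) measurableSet_Ioi h.integrableOn h.integrableOn,
    hpos, hneg]

theorem gaussianPDFReal_zero_one (x : ℝ) :
    gaussianPDFReal 0 1 x = (√(2 * Real.pi))⁻¹ * Real.exp (-(1 / 2) * x ^ 2) := by
  rw [gaussianPDFReal]
  congr 2
  · norm_num
  · push_cast
    ring

theorem integrable_abs_rpow_gaussianReal {p : ℝ} (hp : -1 < p) :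
    Integrable (fun z : ℝ => |z| ^ p) (gaussianReal 0 1) := by
  have h0 : (gaussianReal 0 1 : Measure ℝ) = volume.withDensity
      (fun x => ENNReal.ofReal (gaussianPDFReal 0 1 x)) := by
    rw [gaussianReal_of_var_ne_zero _ one_ne_zero]
    rfl
  rw [h0, integrable_withDensity_iff_integrable_smul' (by fun_prop) (by simp)]
  have h1 := ((integrableOn_rpow_mul_exp_neg_mul_sq (b := 1 / 2) (by norm_num)
    hp).integrable_comp_abs).const_mul (√(2 * Real.pi))⁻¹
  refine h1.congr (ae_of_all _ fun x => ?_)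
  simp only [sq_abs]
  rw [ENNReal.toReal_ofReal (gaussianPDFReal_nonneg _ _ _), gaussianPDFReal_zero_one, smul_eq_mul]
  ring

/-- The integrand is even, so the integral is twice that over the half-line; there the substitution
`x ↦ x²` turns the Gaussian weight into an exponential, whose Mellin transform at `s / 2` is a Gamma
value. -/
theorem integral_abs_cpow_gaussianReal {s : ℂ} (hs : 0 < s.re) :
    ∫ z, ((|z| : ℝ) : ℂ) ^ (s - 1) ∂(gaussianReal 0 1) =
      ((√(2 * Real.pi))⁻¹ : ℝ) * ((((1 / 2 : ℝ) : ℂ) ^ (-(s / 2))) * Complex.Gamma (s / 2)) := by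
  have hint : IntegrableOn
      (fun x : ℝ => gaussianPDFReal 0 1 x • ((x : ℂ) ^ (s - 1))) (Ioi 0) := by
    have h1 := (integrableOn_rpow_mul_exp_neg_mul_sq (b := 1 / 2) (by norm_num)
      (show -1 < s.re - 1 by linarith)).const_mul (√(2 * Real.pi))⁻¹
    refine Integrable.mono' h1 (Measurable.aestronglyMeasurable ?_) ?_
    · exact (measurable_gaussianPDFReal 0 1).smul (by fun_prop)
    · refine (ae_restrict_iff' measurableSet_Ioi).2 (ae_of_all _ fun x hx => ?_)
      rw [norm_smul, Complex.norm_cpow_eq_rpow_re_of_pos hx,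
        Real.norm_of_nonneg (gaussianPDFReal_nonneg _ _ _), gaussianPDFReal_zero_one]
      simp only [Complex.sub_re, Complex.one_re]
      apply le_of_eq
      ring
  have heven := integral_comp_abs_of_integrableOn hint
  have h1 : ∀ x : ℝ, gaussianPDFReal 0 1 |x| = gaussianPDFReal 0 1 x := fun x => by
    simp [gaussianPDFReal_zero_one]
  simp only [h1] at heven
  rw [integral_gaussianReal_eq_integral_smul one_ne_zero, heven]
  have hgamma : mellin (fun x : ℝ => ((Real.exp (-(1 / 2 * x)) : ℝ) : ℂ)) (s / 2) =
      (((1 / 2 : ℝ) : ℂ) ^ (-(s / 2))) * Complex.Gamma (s / 2) := by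
    rw [mellin_comp_mul_left (fun x => ((Real.exp (-x) : ℝ) : ℂ)) _ (by norm_num : (0 : ℝ) < 1 / 2),
      ← Complex.GammaIntegral_eq_mellin, Complex.Gamma_eq_integral, smul_eq_mul]
    simp only [Complex.div_ofNat_re]
    positivity
  have hsq := mellin_comp_rpow (fun x : ℝ => ((Real.exp (-(1 / 2 * x)) : ℝ) : ℂ)) s 2
  rw [Complex.ofReal_ofNat, hgamma] at hsq
  have hm : ∫ x in Ioi (0 : ℝ), gaussianPDFReal 0 1 x • ((x : ℂ) ^ (s - 1)) =
      ((√(2 * Real.pi))⁻¹ : ℝ) *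
        mellin (fun x : ℝ => ((Real.exp (-(1 / 2 * x ^ (2 : ℝ))) : ℝ) : ℂ)) s := by
    rw [mellin, ← integral_const_mul]
    refine setIntegral_congr_fun measurableSet_Ioi fun x _ => ?_
    simp only [gaussianPDFReal_zero_one, Real.rpow_two, smul_eq_mul, Complex.real_smul, neg_mul]
    push_cast
    ring
  rw [hm, hsq]
  simp only [Complex.real_smul, abs_two]
  push_cast
  ring

/-- Mellin transform of the modulus of a standard normal variable. -/
theorem absMellin_gaussian {Ω : Type*} [MeasurableSpace Ω] {P : Measure Ω} {Z : Ω → ℝ}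
    (hZ : HasLaw Z (gaussianReal 0 1) P) {s : ℂ} (hs : 0 < s.re) :
    absMellin P Z s =
      ((√(2 * Real.pi))⁻¹ : ℝ) * ((((1 / 2 : ℝ) : ℂ) ^ (-(s / 2))) * Complex.Gamma (s / 2)) := by
  rw [← integral_abs_cpow_gaussianReal hs, absMellin]
  have hm : Measurable (fun z : ℝ => ((|z| : ℝ) : ℂ) ^ (s - 1)) := by fun_prop
  exact hZ.integral_comp hm.aestronglyMeasurable

theorem div_two_mellinLine {H : ℝ} (hH : 0 < H) (γ v : ℝ) :
    ((γ : ℂ) + H - 1 + v * Complex.I) / H / 2 =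
      (((γ + H - 1) / (2 * H) : ℝ) : ℂ) + ((v / (2 * H) : ℝ) : ℂ) * Complex.I := by
  have : (H : ℂ) ≠ 0 := by exact_mod_cast hH.ne'
  push_cast
  field_simp

theorem re_mellinLine {H : ℝ} (γ v : ℝ) :
    (((γ : ℂ) + H - 1 + v * Complex.I) / H).re = (γ + H - 1) / H := by
  rw [Complex.div_ofReal_re]
  simp

theorem absMellin_line_ne_zero {Ω : Type*} [MeasurableSpace Ω] {P : Measure Ω} {Z : Ω → ℝ}
    (hZ : HasLaw Z (gaussianReal 0 1) P) {H γ : ℝ} (hH : 0 < H) (hγ : 0 < γ + H - 1) (v : ℝ) :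
    absMellin P Z (((γ : ℂ) + H - 1 + v * Complex.I) / H) ≠ 0 := by
  have hre : 0 < (((γ : ℂ) + H - 1 + v * Complex.I) / H).re := by
    rw [re_mellinLine]
    positivity
  rw [absMellin_gaussian hZ hre]
  refine mul_ne_zero ?_ (mul_ne_zero ?_ (Complex.Gamma_ne_zero_of_re_pos ?_))
  · exact_mod_cast (by positivity : (√(2 * Real.pi))⁻¹ ≠ 0)
  · simp [Complex.cpow_eq_zero_iff]
  · simp only [Complex.div_ofNat_re]
    positivity

theorem continuous_absMellin_line {Ω : Type*} [MeasurableSpace Ω] {P : Measure Ω} {Z : Ω → ℝ}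
    (hZ : HasLaw Z (gaussianReal 0 1) P) {H γ : ℝ} (hH : 0 < H) (hγ : 0 < γ + H - 1) :
    Continuous (fun v : ℝ => absMellin P Z (((γ : ℂ) + H - 1 + v * Complex.I) / H)) := by
  have hre : ∀ v : ℝ, 0 < (((γ : ℂ) + H - 1 + v * Complex.I) / H).re := fun v => by
    rw [re_mellinLine]
    positivity
  simp_rw [absMellin_gaussian hZ (hre _)]
  have hline : Continuous fun v : ℝ => ((γ : ℂ) + H - 1 + v * Complex.I) / H / 2 := by fun_prop
  refine continuous_const.mul (Continuous.mul ?_ ?_)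
  · exact hline.neg.const_cpow (Or.inl (by norm_num))
  · rw [continuous_iff_continuousAt]
    intro v
    refine ContinuousAt.comp (f := fun v : ℝ => ((γ : ℂ) + H - 1 + v * Complex.I) / H / 2)
      (Complex.differentiableAt_Gamma _ fun m hm => ?_).continuousAt hline.continuousAt
    have h1 := congrArg Complex.re hm
    have h2 := hre v
    simp only [Complex.div_ofNat_re, Complex.neg_re, Complex.natCast_re] at h1
    have : (0 : ℝ) ≤ m := m.cast_nonneg
    linarith

theorem exists_norm_inv_absMellin_le {Ω : Type*} [MeasurableSpace Ω] {P : Measure Ω} {Z : Ω → ℝ}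
    (hZ : HasLaw Z (gaussianReal 0 1) P) {H γ : ℝ} (hH : 0 < H) (hγ : 0 < γ + H - 1) :
    ∃ C : ℝ, 0 < C ∧ ∀ v : ℝ,
      ‖(absMellin P Z (((γ : ℂ) + H - 1 + v * Complex.I) / H))⁻¹‖ ≤
        C * (1 + |v|) ^ (max 0 ((1 - γ) / (2 * H))) * Real.exp (Real.pi / (4 * H) * |v|) := by
  set σ : ℝ := (γ + H - 1) / (2 * H) with hσ
  have hσ0 : 0 < σ := by positivity
  obtain ⟨c, hc, hcb⟩ := exists_norm_Gamma_ge hσ0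
  -- This is where the threshold `γ = 1` arises: `σ ≥ 1/2` exactly when `γ ≥ 1`, and only below it
  -- is a power of `|v|` lost.
  have hp : 1 / 2 - σ = (1 - γ) / (2 * H) := by
    rw [hσ]
    field_simp
    ring
  rw [hp] at hcb
  set p := max 0 ((1 - γ) / (2 * H)) with hpdef
  have hp0 : 0 ≤ p := le_max_left _ _
  have hpi : 0 < √(2 * Real.pi) := by positivity
  set A : ℝ := (√(2 * Real.pi))⁻¹ * (1 / 2) ^ (-σ) with hA
  have hA0 : 0 < A := by positivity
  refine ⟨A⁻¹ * c⁻¹ * (1 + 1 / (2 * H)) ^ p, by positivity, fun v => ?_⟩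
  have hre : 0 < (((γ : ℂ) + H - 1 + v * Complex.I) / H).re := by
    rw [re_mellinLine]
    positivity
  rw [absMellin_gaussian hZ hre, div_two_mellinLine hH, norm_inv, norm_mul, norm_mul,
    Complex.norm_real, Complex.norm_cpow_eq_rpow_re_of_pos (by norm_num), ← mul_assoc,
    Real.norm_of_nonneg (inv_nonneg.2 hpi.le)]
  have h1 : (-((σ : ℂ) + ((v / (2 * H) : ℝ) : ℂ) * Complex.I)).re = -σ := by
    rw [Complex.neg_re, Complex.add_re, Complex.re_ofReal_mul]
    simp
  rw [h1, ← hA]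
  set t := v / (2 * H) with ht
  have habs : |t| = |v| / (2 * H) := by rw [ht, abs_div, abs_of_pos (by positivity : 0 < 2 * H)]
  have hb := hcb t
  have hpos : 0 < c * (1 + |t|) ^ (-p) * Real.exp (-(Real.pi * |t| / 2)) := by positivity
  calc (A * ‖Complex.Gamma (σ + t * Complex.I)‖)⁻¹
      ≤ (A * (c * (1 + |t|) ^ (-p) * Real.exp (-(Real.pi * |t| / 2))))⁻¹ := by gcongr
    _ = A⁻¹ * c⁻¹ * (1 + |t|) ^ p * Real.exp (Real.pi / (4 * H) * |v|) := by
        have h2 : Real.pi / (4 * H) * |v| = Real.pi * |t| / 2 := by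
          rw [habs]
          field_simp
          ring
        rw [Real.rpow_neg (by positivity), Real.exp_neg, h2]
        clear_value A
        simp only [mul_inv, inv_inv]
        ring
    _ ≤ A⁻¹ * c⁻¹ * ((1 + 1 / (2 * H)) * (1 + |v|)) ^ p *
          Real.exp (Real.pi / (4 * H) * |v|) := by
        have : 1 + |t| ≤ (1 + 1 / (2 * H)) * (1 + |v|) := by
          have h3 : |t| = 1 / (2 * H) * |v| := by rw [habs]; ring
          have h4 : 0 < 1 / (2 * H) := by positivity
          rw [h3]
          nlinarith [abs_nonneg v]
        gcongr
    _ = _ := by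
        rw [Real.mul_rpow (by positivity) (by positivity)]
        ring

/-- Bound for the integral of the reciprocal Mellin transform over the window `[-g, g]`. -/
theorem exists_integral_norm_inv_absMellin_le {Ω : Type*} [MeasurableSpace Ω] {P : Measure Ω}
    {Z : Ω → ℝ} (hZ : HasLaw Z (gaussianReal 0 1) P) {H γ : ℝ} (hH : 0 < H)
    (hγ : 0 < γ + H - 1) :
    ∃ C : ℝ, 0 < C ∧ ∀ g : ℝ, 1 ≤ g →
      ∫ v in (-g)..g, ‖(absMellin P Z (((γ : ℂ) + H - 1 + v * Complex.I) / H))⁻¹‖ ≤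
        C * g ^ (max 0 ((1 - γ) / (2 * H))) * Real.exp (Real.pi / (4 * H) * g) := by
  obtain ⟨C, hC, hb⟩ := exists_norm_inv_absMellin_le hZ hH hγ
  set p := max 0 ((1 - γ) / (2 * H)) with hpdef
  have hp0 : 0 ≤ p := le_max_left _ _
  set κ := Real.pi / (4 * H) with hκ
  have hκ0 : 0 < κ := by positivity
  have hcont : Continuous fun v : ℝ =>
      ‖(absMellin P Z (((γ : ℂ) + H - 1 + v * Complex.I) / H))⁻¹‖ :=
    ((continuous_absMellin_line hZ hH hγ).inv₀ (absMellin_line_ne_zero hZ hH hγ)).norm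
  refine ⟨C * 2 ^ p * (2 / κ), by positivity, fun g hg => ?_⟩
  have hg0 : 0 < g := by linarith
  have hexp : ∀ c : ℝ, c ≠ 0 → ∀ a b : ℝ,
      ∫ v in a..b, Real.exp (c * v) = (Real.exp (c * b) - Real.exp (c * a)) / c := by
    intro c hc a b
    rw [intervalIntegral.integral_comp_mul_left _ hc, integral_exp, smul_eq_mul]
    field_simp
  -- The exponential is integrated in closed form instead of being bounded by its maximum, so the
  -- window length costs no extra factor `g`. The bound `1 + |v| ≤ 2 * g` uses `1 ≤ g`.
  calc _ ≤ ∫ v in (-g)..g, C * (2 * g) ^ p * (Real.exp (κ * v) + Real.exp (-κ * v)) := by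
        refine intervalIntegral.integral_mono_on (by linarith) (hcont.intervalIntegrable _ _)
          (Continuous.intervalIntegrable (by fun_prop) _ _) fun v hv => ?_
        refine (hb v).trans ?_
        have hv' : |v| ≤ g := abs_le.2 hv
        have h1 : 1 + |v| ≤ 2 * g := by linarith
        have h2 : Real.exp (κ * |v|) ≤ Real.exp (κ * v) + Real.exp (-κ * v) := by
          rcases abs_cases v with ⟨h, -⟩ | ⟨h, -⟩ <;> rw [h]
          · linarith [Real.exp_nonneg (-κ * v)]
          · rw [mul_neg, ← neg_mul]
            linarith [Real.exp_nonneg (κ * v)]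
        gcongr
    _ = C * (2 * g) ^ p * (2 / κ * (Real.exp (κ * g) - Real.exp (-(κ * g)))) := by
        rw [intervalIntegral.integral_const_mul, intervalIntegral.integral_add
          (Continuous.intervalIntegrable (by fun_prop) _ _)
          (Continuous.intervalIntegrable (by fun_prop) _ _), hexp κ hκ0.ne',
          hexp (-κ) (neg_ne_zero.2 hκ0.ne')]
        congr 1
        simp only [mul_neg, neg_mul, neg_neg]
        field_simp
        ring
    _ ≤ C * (2 * g) ^ p * (2 / κ * Real.exp (κ * g)) := by
        gcongr
        linarith [Real.exp_nonneg (-(κ * g))]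
    _ = _ := by
        rw [Real.mul_rpow (by norm_num) hg0.le]
        ring

end GaussianMoments

/-! ### Exponential decay of the Mellin transform and the truncation bias -/

section MellinDecay

theorem integrable_exp_neg_mul_abs {δ : ℝ} (hδ : 0 < δ) :
    Integrable (fun u : ℝ => Real.exp (-δ * |u|)) :=
  (integrableOn_exp_mul_Ioi (neg_neg_of_pos hδ) 0).integrable_comp_abs

/-- Cauchy's theorem on the rectangle over `[-N, N]` with heights `0` and `θ`; the exponential bound
kills the vertical sides as `N → ∞`. -/
theorem integral_horizontal_shift {h : ℂ → ℂ} {θ K δ : ℝ} (hδ : 0 < δ)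
    (hd : DifferentiableOn ℂ h {w | w.im ∈ uIcc 0 θ})
    (hb : ∀ u y : ℝ, y ∈ uIcc 0 θ → ‖h (u + y * Complex.I)‖ ≤ K * Real.exp (-δ * |u|)) :
    ∫ u : ℝ, h u = ∫ u : ℝ, h (u + θ * Complex.I) := by
  have hint : ∀ y ∈ uIcc 0 θ, Integrable (fun u : ℝ => h (u + y * Complex.I)) := by
    intro y hy
    refine Integrable.mono' ((integrable_exp_neg_mul_abs hδ).const_mul K) ?_
      (ae_of_all _ fun u => hb u y hy)
    refine Continuous.aestronglyMeasurable ?_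
    refine hd.continuousOn.comp_continuous (by fun_prop) fun u => ?_
    simpa using hy
  have h0 : Tendsto (fun N : ℝ => ∫ u in (-N)..N, h (u + (0 : ℝ) * Complex.I)) atTop
      (𝓝 (∫ u : ℝ, h (u + (0 : ℝ) * Complex.I))) :=
    intervalIntegral_tendsto_integral (hint 0 left_mem_uIcc) tendsto_neg_atTop_atBot tendsto_id
  have h1 : Tendsto (fun N : ℝ => ∫ u in (-N)..N, h (u + θ * Complex.I)) atTop
      (𝓝 (∫ u : ℝ, h (u + θ * Complex.I))) :=
    intervalIntegral_tendsto_integral (hint θ right_mem_uIcc) tendsto_neg_atTop_atBot tendsto_id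
  have hside : ∀ s : ℝ, s = 1 ∨ s = -1 →
      Tendsto (fun N : ℝ => ∫ y in (0 : ℝ)..θ, h (((s * N : ℝ) : ℂ) + y * Complex.I)) atTop (𝓝 0) := by
    intro s hs
    have hlim : Tendsto (fun N : ℝ => K * Real.exp (-δ * N) * |θ - 0|) atTop (𝓝 0) := by
      have : Tendsto (fun N : ℝ => -δ * N) atTop atBot :=
        tendsto_id.const_mul_atTop_of_neg (neg_neg_of_pos hδ)
      simpa using ((Real.tendsto_exp_atBot.comp this).const_mul K).mul_const |θ - 0|
    refine squeeze_zero_norm' ?_ hlim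
    filter_upwards [eventually_ge_atTop 0] with N hN
    refine intervalIntegral.norm_integral_le_of_norm_le_const fun y hy => ?_
    refine (hb (s * N) y (uIoc_subset_uIcc hy)).trans_eq ?_
    rcases hs with rfl | rfl
    · rw [one_mul, abs_of_nonneg hN]
    · rw [neg_one_mul, abs_neg, abs_of_nonneg hN]
  have hrect : ∀ N : ℝ, (∫ u in (-N)..N, h (u + (0 : ℝ) * Complex.I)) =
      (∫ u in (-N)..N, h (u + θ * Complex.I)) -
        Complex.I • (∫ y in (0 : ℝ)..θ, h (((1 * N : ℝ) : ℂ) + y * Complex.I)) +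
        Complex.I • (∫ y in (0 : ℝ)..θ, h (((-1 * N : ℝ) : ℂ) + y * Complex.I)) := by
    intro N
    have := Complex.integral_boundary_rect_eq_zero_of_differentiableOn h (((-N : ℝ) : ℂ))
      (N + θ * Complex.I) (hd.mono fun w hw => by simpa using hw.2)
    simp only [Complex.ofReal_re, Complex.ofReal_im, Complex.add_re, Complex.add_im,
      Complex.mul_re, Complex.mul_im, Complex.I_re, Complex.I_im, mul_zero, mul_one,
      add_zero, zero_add, sub_self] at this
    rw [one_mul, neg_one_mul]
    linear_combination this
  have h2 : Tendsto (fun N : ℝ => ∫ u in (-N)..N, h (u + (0 : ℝ) * Complex.I)) atTop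
      (𝓝 ((∫ u : ℝ, h (u + θ * Complex.I)) - Complex.I • (0 : ℂ) + Complex.I • (0 : ℂ))) := by
    simp_rw [hrect]
    exact (h1.sub ((hside 1 (Or.inl rfl)).const_smul _)).add ((hside (-1) (Or.inr rfl)).const_smul _)
  have := tendsto_nhds_unique h0 h2
  simpa using this

theorem exp_mem_sector {β : ℝ} (hβ : β < Real.pi) {u θ : ℝ} (hθ : |θ| ≤ β) :
    Complex.exp (u + θ * Complex.I) ∈ sector β := by
  refine ⟨Complex.exp_ne_zero _, ?_⟩
  have h := abs_le.1 hθ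
  rw [← Complex.log_im, Complex.log_exp]
  · simpa using hθ
  · simp only [Complex.add_im, Complex.ofReal_im, Complex.im_ofReal_mul,
      Complex.I_im, mul_one, zero_add]
    linarith
  · simp only [Complex.add_im, Complex.ofReal_im, Complex.im_ofReal_mul, Complex.I_im, mul_one,
      zero_add]
    linarith

/-- In the coordinate `z = exp (u + iθ)` the two growth conditions become decay at rates `γ - a` as
`u → -∞` and `b - γ` as `u → ∞`. Between them, continuity on a compact rectangle suffices. -/
theorem exists_sector_bound {β a b γ : ℝ} (hβ : β < Real.pi) {F : ℂ → ℂ}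
    (hF : AnalyticOnNhd ℂ F (sector β))
    (h0 : F =O[𝓝 0 ⊓ 𝓟 (sector β)] (fun z => ‖z‖ ^ (-a)))
    (hinf : F =O[Bornology.cobounded ℂ ⊓ 𝓟 (sector β)] (fun z => ‖z‖ ^ (-b)))
    (hγ : γ ∈ Ioo a b) :
    ∃ K δ : ℝ, 0 < K ∧ 0 < δ ∧ ∀ u θ : ℝ, |θ| ≤ β →
      ‖F (Complex.exp (u + θ * Complex.I))‖ * Real.exp (γ * u) ≤ K * Real.exp (-δ * |u|) := by
  have hnorm : ∀ u θ : ℝ, ‖Complex.exp (u + θ * Complex.I)‖ = Real.exp u := by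
    intro u θ
    simp [Complex.norm_exp]
  have hpow : ∀ u c : ℝ, Real.exp u ^ c = Real.exp (c * u) := fun u c => by
    rw [← Real.exp_mul, mul_comm]
  obtain ⟨C₀, hC₀, hb₀⟩ := h0.exists_pos
  obtain ⟨C₁, hC₁, hb₁⟩ := hinf.exists_pos
  have hb₀ := hb₀.bound
  have hb₁ := hb₁.bound
  rw [eventually_inf_principal] at hb₀ hb₁
  obtain ⟨ε, hε, hb₀⟩ := Metric.eventually_nhds_iff.1 hb₀
  obtain ⟨R, -, hb₁⟩ := (hasBasis_cobounded_norm (E := ℂ)).eventually_iff.1 hb₁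
  -- Beyond `±U` the point `exp u` lies in the range of one of the two growth bounds; the entry `1`
  -- fixes the sign of `u`, and the `1` in `1 - Real.log ε` makes the inequality near `0` strict.
  set U := max 1 (max (Real.log R) (1 - Real.log ε)) with hU
  have hU1 : 1 ≤ U := le_max_left _ _
  set δ := min (γ - a) (b - γ) with hδ
  have hδ0 : 0 < δ := lt_min (by linarith [hγ.1]) (by linarith [hγ.2])
  have hcont : ContinuousOn (fun p : ℝ × ℝ =>
      ‖F (Complex.exp (p.1 + p.2 * Complex.I))‖ * Real.exp (γ * p.1) * Real.exp (δ * |p.1|))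
      (Icc (-U) U ×ˢ Icc (-β) β) := by
    refine ContinuousOn.mul (ContinuousOn.mul (ContinuousOn.norm ?_) (by fun_prop)) (by fun_prop)
    exact hF.continuousOn.comp (by fun_prop) fun p hp =>
      exp_mem_sector hβ (abs_le.2 hp.2)
  obtain ⟨C₂, hC₂⟩ := (isCompact_Icc.prod isCompact_Icc).bddAbove_image hcont
  refine ⟨C₀ + C₁ + |C₂|, δ, by positivity, hδ0, fun u θ hθ => ?_⟩
  have hmem := exp_mem_sector hβ (u := u) hθ
  have hpos := Real.exp_pos (-δ * |u|)
  rcases lt_or_ge U u with hu | hu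
  · have hR : R ≤ ‖Complex.exp (u + θ * Complex.I)‖ := by
      rw [hnorm]
      rcases le_or_gt R 0 with hR | hR
      · exact hR.trans (Real.exp_nonneg _)
      · rw [← Real.log_le_iff_le_exp hR]
        exact ((le_max_left _ _).trans (le_max_right _ _)).trans hu.le
    have h1 := hb₁ hR hmem
    rw [hnorm, Real.norm_of_nonneg (by positivity), hpow] at h1
    have hu0 : 0 < u := by linarith
    calc _ ≤ C₁ * Real.exp (-b * u) * Real.exp (γ * u) := by gcongr
      _ = C₁ * Real.exp ((γ - b) * u) := by
          rw [mul_assoc, ← Real.exp_add]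
          congr 2
          ring
      _ ≤ C₁ * Real.exp (-δ * |u|) := by
          rw [abs_of_pos hu0]
          gcongr
          linarith [min_le_right (γ - a) (b - γ)]
      _ ≤ _ := by
          gcongr
          linarith [abs_nonneg C₂]
  rcases lt_or_ge u (-U) with hu' | hu'
  · have hR : dist (Complex.exp (u + θ * Complex.I)) 0 < ε := by
      rw [dist_zero_right, hnorm, ← Real.lt_log_iff_exp_lt hε]
      linarith [(le_max_right (Real.log R) (1 - Real.log ε)).trans (le_max_right 1 _)]
    have h1 := hb₀ hR hmem
    rw [hnorm, Real.norm_of_nonneg (by positivity), hpow] at h1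
    have hu0 : u < 0 := by linarith
    calc _ ≤ C₀ * Real.exp (-a * u) * Real.exp (γ * u) := by gcongr
      _ = C₀ * Real.exp ((γ - a) * u) := by
          rw [mul_assoc, ← Real.exp_add]
          congr 2
          ring
      _ ≤ C₀ * Real.exp (-δ * |u|) := by
          rw [abs_of_neg hu0]
          gcongr ?_ * Real.exp ?_
          nlinarith [min_le_left (γ - a) (b - γ)]
      _ ≤ _ := by
          gcongr
          linarith [abs_nonneg C₂]
  · have h1 := hC₂ (mem_image_of_mem _ (show (u, θ) ∈ Icc (-U) U ×ˢ Icc (-β) β from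
      ⟨⟨hu', hu⟩, abs_le.1 hθ⟩))
    simp only at h1
    have h2 : Real.exp (δ * |u|) * Real.exp (-δ * |u|) = 1 := by
      rw [← Real.exp_add]
      simp
    calc _ = ‖F (Complex.exp (u + θ * Complex.I))‖ * Real.exp (γ * u) * Real.exp (δ * |u|) *
          Real.exp (-δ * |u|) := by rw [mul_assoc _ (Real.exp (δ * |u|)), h2, mul_one]
      _ ≤ C₂ * Real.exp (-δ * |u|) := by gcongr
      _ ≤ _ := by
          gcongr
          linarith [le_abs_self C₂]

/-- The substitution `x = exp u` turns rotation of the ray inside the sector into vertical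
translation of the real line. -/
theorem mellin_eq_integral_exp (f : ℝ → ℂ) (s : ℂ) :
    mellin f s = ∫ u : ℝ, f (Real.exp u) * Complex.exp (s * u) := by
  rw [mellin, ← Real.range_exp, ← image_univ,
    integral_image_eq_integral_abs_deriv_smul MeasurableSet.univ
      (fun x _ => (Real.hasDerivAt_exp x).hasDerivWithinAt) Real.exp_injective.injOn,
    Measure.restrict_univ]
  congr 1
  ext u
  have h : (((Real.exp u : ℝ) : ℂ)) ^ (s - 1) = Complex.exp (s * u) * (Complex.exp u)⁻¹ := by
    rw [Complex.cpow_def_of_ne_zero (by exact_mod_cast (Real.exp_pos u).ne'),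
      ← Complex.ofReal_log (Real.exp_nonneg _), Real.log_exp, ← Complex.exp_neg, ← Complex.exp_add]
    congr 1
    ring
  rw [h, abs_of_pos (Real.exp_pos u), Complex.real_smul, smul_eq_mul, Complex.ofReal_exp]
  have := Complex.exp_ne_zero (u : ℂ)
  field_simp

/-- Moving the line to height `y` multiplies the modulus of the exponential factor by `exp (-v y)`,
while the sector bound on `F` is uniform in `y`. -/
theorem exists_norm_mellin_le {β a b γ : ℝ} (hβ0 : 0 < β) (hβ : β < Real.pi) {f : ℝ → ℝ}
    {F : ℂ → ℂ} (hF : AnalyticOnNhd ℂ F (sector β)) (hFf : ∀ x : ℝ, 0 < x → F (x : ℂ) = (f x : ℂ))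
    (h0 : F =O[𝓝 0 ⊓ 𝓟 (sector β)] (fun z => ‖z‖ ^ (-a)))
    (hinf : F =O[Bornology.cobounded ℂ ⊓ 𝓟 (sector β)] (fun z => ‖z‖ ^ (-b)))
    (hγ : γ ∈ Ioo a b) :
    Continuous (fun v : ℝ => mellin (fun x => (f x : ℂ)) (γ + v * Complex.I)) ∧
    ∃ C : ℝ, 0 < C ∧ ∀ v : ℝ,
      ‖mellin (fun x => (f x : ℂ)) (γ + v * Complex.I)‖ ≤ C * Real.exp (-β * |v|) := by
  obtain ⟨K, δ, hK, hδ, hb⟩ := exists_sector_bound hβ hF h0 hinf hγ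
  have hint := (integrable_exp_neg_mul_abs hδ).const_mul K
  set h : ℝ → ℂ → ℂ := fun v w => F (Complex.exp w) * Complex.exp ((γ + v * Complex.I) * w) with hh
  have hmellin : ∀ v : ℝ, mellin (fun x => (f x : ℂ)) (γ + v * Complex.I) = ∫ u : ℝ, h v u := by
    intro v
    rw [mellin_eq_integral_exp]
    congr 1
    ext u
    simp only [hh]
    rw [← hFf _ (Real.exp_pos u), Complex.ofReal_exp]
  have hnorm : ∀ v u y : ℝ, |y| ≤ β →
      ‖h v (u + y * Complex.I)‖ ≤ Real.exp (-(v * y)) * (K * Real.exp (-δ * |u|)) := by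
    intro v u y hy
    have h1 : ‖Complex.exp ((γ + v * Complex.I) * (u + y * Complex.I))‖ =
        Real.exp (γ * u) * Real.exp (-(v * y)) := by
      rw [Complex.norm_exp, ← Real.exp_add]
      congr 1
      simp [Complex.mul_re]
      ring
    rw [hh]
    simp only
    rw [norm_mul, h1, ← mul_assoc, mul_comm]
    exact mul_le_mul_of_nonneg_left (hb u y hy) (Real.exp_nonneg _)
  have hdiff : ∀ v : ℝ, DifferentiableOn ℂ (h v) {w | |w.im| ≤ β} := by
    intro v w hw
    have hmem : Complex.exp w ∈ sector β := by
      have := exp_mem_sector hβ (u := w.re) hw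
      rwa [Complex.re_add_im] at this
    refine DifferentiableAt.differentiableWithinAt ?_
    refine DifferentiableAt.mul ?_ (by fun_prop)
    exact (hF _ hmem).differentiableAt.comp w Complex.differentiable_exp.differentiableAt
  constructor
  · simp_rw [hmellin]
    refine continuous_of_dominated (bound := fun u => K * Real.exp (-δ * |u|)) (fun v => ?_)
      (fun v => ae_of_all _ fun u => ?_) hint (ae_of_all _ fun u => ?_)
    · refine Continuous.aestronglyMeasurable ?_
      exact (hdiff v).continuousOn.comp_continuous (by fun_prop) fun u => by simpa using hβ0.le
    · have := hnorm v u 0 (by simpa using hβ0.le)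
      simpa using this
    · simp only [hh]
      fun_prop
  · refine ⟨∫ u : ℝ, K * Real.exp (-δ * |u|), ?_, fun v => ?_⟩
    · rw [integral_pos_iff_support_of_nonneg (fun u => by positivity) hint]
      have : Function.support (fun u : ℝ => K * Real.exp (-δ * |u|)) = univ := by
        ext u
        simp [hK.ne', Real.exp_ne_zero]
      rw [this]
      simp
    -- The direction of the shift follows the sign of `v`, so that the gain is always `exp (-β
    -- |v|)`.
    obtain ⟨θ, hθ, hvθ⟩ : ∃ θ : ℝ, |θ| = β ∧ v * θ = β * |v| := by
      rcases abs_cases v with ⟨h1, -⟩ | ⟨h1, -⟩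
      · exact ⟨β, abs_of_pos hβ0, by rw [h1]; ring⟩
      · exact ⟨-β, by rw [abs_neg, abs_of_pos hβ0], by rw [h1]; ring⟩
    have hsub : ∀ y ∈ uIcc 0 θ, |y| ≤ β := by
      intro y hy
      have := abs_sub_left_of_mem_uIcc hy
      simpa [hθ] using this
    have hexp : ∀ y : ℝ, |y| ≤ β → -(v * y) ≤ |v| * β := by
      intro y hy
      refine (neg_le_abs _).trans ?_
      rw [abs_mul]
      gcongr
    rw [hmellin, integral_horizontal_shift (h := h v) (θ := θ) (K := Real.exp (|v| * β) * K) hδ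
      ((hdiff v).mono fun w hw => hsub _ hw) fun u y hy => ?_, ← integral_mul_const]
    · refine norm_integral_le_of_norm_le (hint.mul_const _) (ae_of_all _ fun u => ?_)
      refine (hnorm v u θ hθ.le).trans_eq ?_
      rw [hvθ, mul_comm, neg_mul β]
    · refine (hnorm v u y (hsub y hy)).trans ?_
      rw [mul_assoc]
      gcongr
      exact hexp y (hsub y hy)

theorem MellinClass.mellinConvergent {a b γ : ℝ} {f : ℝ → ℝ} (hf : MellinClass a b f)
    (hγ : γ ∈ Ioo a b) (v : ℝ)
    (hmeas : AEStronglyMeasurable (fun x => (f x : ℂ)) (volume.restrict (Ioi 0))) :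
    MellinConvergent (fun x => (f x : ℂ)) (γ + v * Complex.I) := by
  refine Integrable.mono (hf γ hγ) ?_ ?_
  · exact AEStronglyMeasurable.smul (show Measurable fun x : ℝ =>
      (x : ℂ) ^ ((γ : ℂ) + v * Complex.I - 1) by fun_prop).aestronglyMeasurable hmeas
  · refine (ae_restrict_iff' measurableSet_Ioi).2 (ae_of_all _ fun x hx => ?_)
    have hx' : (0 : ℝ) < x := hx
    rw [norm_smul, Complex.norm_cpow_eq_rpow_re_of_pos hx, norm_mul, Complex.norm_real, mul_comm,
      Real.norm_of_nonneg (Real.rpow_nonneg hx'.le (γ - 1))]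
    simp

/-- Truncation error in the Mellin inversion formula. -/
theorem exists_norm_sub_truncated_mellinInv_le {β a b γ : ℝ} (hβ : β ∈ Ioo 0 Real.pi) {f : ℝ → ℝ}
    (hf : ClassC β a b f) (hγ : γ ∈ Ioo a b) :
    ∃ C : ℝ, 0 < C ∧ ∀ g : ℝ, 0 ≤ g → ∀ x : ℝ, 0 < x →
      ‖(f x : ℂ) - (1 / (2 * (Real.pi : ℂ))) * ∫ v in (-g)..g,
        mellin (fun x => (f x : ℂ)) (γ + v * Complex.I) * (x : ℂ) ^ (-(γ : ℂ) - v * Complex.I)‖ ≤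
      C * x ^ (-γ) * Real.exp (-β * g) := by
  obtain ⟨hM, F, hF, hFf, h0, hinf⟩ := hf
  obtain ⟨hcont, C, hC, hb⟩ := exists_norm_mellin_le hβ.1 hβ.2 hF hFf h0 hinf hγ
  have hfcont : ∀ x : ℝ, 0 < x → ContinuousAt (fun x => (f x : ℂ)) x := by
    intro x hx
    have hmem : (x : ℂ) ∈ sector β := by
      refine ⟨by exact_mod_cast hx.ne', ?_⟩
      rw [Complex.arg_ofReal_of_nonneg hx.le, abs_zero]
      exact hβ.1.le
    have h1 : ContinuousAt (fun x : ℝ => F x) x :=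
      ContinuousAt.comp (hF _ hmem).continuousAt Complex.continuous_ofReal.continuousAt
    refine h1.congr ?_
    filter_upwards [lt_mem_nhds hx] with y hy
    exact hFf y hy
  have hmeas : AEStronglyMeasurable (fun x => (f x : ℂ)) (volume.restrict (Ioi 0)) :=
    ContinuousOn.aestronglyMeasurable (fun x hx => (hfcont x hx).continuousWithinAt)
      measurableSet_Ioi
  have hexpint := integrable_exp_neg_mul_abs hβ.1
  -- The exponential decay provides the vertical integrability that Mellin inversion requires.
  have hvert : Complex.VerticalIntegrable (mellin fun x => (f x : ℂ)) γ :=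
    Integrable.mono' (hexpint.const_mul C) hcont.aestronglyMeasurable (ae_of_all _ hb)
  have hconv : MellinConvergent (fun x => (f x : ℂ)) γ := by
    simpa using hM.mellinConvergent hγ 0 hmeas
  refine ⟨1 / (2 * Real.pi) * (C * (2 / β)), by have := hβ.1; positivity, fun g hg x hx => ?_⟩
  have hinv := mellinInv_mellin_eq γ (fun x => (f x : ℂ)) hx hconv hvert (hfcont x hx)
  set φ : ℝ → ℂ := fun v => mellin (fun x => (f x : ℂ)) (γ + v * Complex.I) *
    (x : ℂ) ^ (-(γ : ℂ) - v * Complex.I) with hφ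
  have hφnorm : ∀ v, ‖φ v‖ ≤ C * x ^ (-γ) * Real.exp (-β * |v|) := by
    intro v
    simp only [hφ]
    rw [norm_mul, Complex.norm_cpow_eq_rpow_re_of_pos hx]
    simp only [Complex.sub_re, Complex.neg_re, Complex.ofReal_re, Complex.re_ofReal_mul,
      Complex.I_re, mul_zero, sub_zero]
    rw [mul_right_comm]
    gcongr
    exact hb v
  have hφint : Integrable φ := by
    refine Integrable.mono' (hexpint.const_mul (C * x ^ (-γ))) ?_ (ae_of_all _ hφnorm)
    refine (hcont.mul ?_).aestronglyMeasurable
    exact Continuous.const_cpow (by fun_prop) (Or.inl (by exact_mod_cast hx.ne'))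
  have hfx : (f x : ℂ) = (1 / (2 * (Real.pi : ℂ))) * ∫ v, φ v := by
    rw [← hinv, mellinInv, Complex.real_smul]
    push_cast
    congr 2
    ext v
    rw [smul_eq_mul, mul_comm, neg_add']
  have hsplit : (∫ v, φ v) - ∫ v in (-g)..g, φ v = (∫ v in Iic (-g), φ v) + ∫ v in Ioi g, φ v := by
    rw [← intervalIntegral.integral_Iic_sub_Iic hφint.integrableOn hφint.integrableOn,
      ← intervalIntegral.integral_Iic_add_Ioi (b := g) hφint.integrableOn hφint.integrableOn]
    ring
  have hleft : ‖∫ v in Iic (-g), φ v‖ ≤ C * x ^ (-γ) * (Real.exp (-β * g) / β) := by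
    refine (norm_integral_le_of_norm_le (g := fun v => C * x ^ (-γ) * Real.exp (β * v))
      ((integrableOn_exp_mul_Iic hβ.1 _).const_mul _) ?_).trans_eq ?_
    · refine (ae_restrict_iff' measurableSet_Iic).2 (ae_of_all _ fun v hv => ?_)
      have := hφnorm v
      rwa [abs_of_nonpos ((mem_Iic.1 hv).trans (neg_nonpos.2 hg)), neg_mul_neg] at this
    · rw [integral_const_mul, integral_exp_mul_Iic hβ.1, mul_neg, neg_mul]
  have hright : ‖∫ v in Ioi g, φ v‖ ≤ C * x ^ (-γ) * (Real.exp (-β * g) / β) := by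
    refine (norm_integral_le_of_norm_le (g := fun v => C * x ^ (-γ) * Real.exp (-β * v))
      ((integrableOn_exp_mul_Ioi (neg_neg_of_pos hβ.1) _).const_mul _) ?_).trans_eq ?_
    · refine (ae_restrict_iff' measurableSet_Ioi).2 (ae_of_all _ fun v hv => ?_)
      have := hφnorm v
      rwa [abs_of_nonneg (hg.trans (mem_Ioi.1 hv).le)] at this
    · rw [integral_const_mul, integral_exp_mul_Ioi (neg_neg_of_pos hβ.1), neg_div_neg_eq]
  rw [hfx, ← mul_sub, hsplit, norm_mul]
  have hpi : ‖(1 / (2 * (Real.pi : ℂ)))‖ = 1 / (2 * Real.pi) := by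
    rw [norm_div, norm_mul, Complex.norm_real, Real.norm_of_nonneg Real.pi_pos.le]
    simp
  rw [hpi]
  calc _ ≤ 1 / (2 * Real.pi) * (C * x ^ (-γ) * (Real.exp (-β * g) / β) +
        C * x ^ (-γ) * (Real.exp (-β * g) / β)) := by
        gcongr
        exact (norm_add_le _ _).trans (add_le_add hleft hright)
    _ = _ := by ring

end MellinDecay

/-! ### The law of the process at an independent random time -/

section TimeChange

/-- Upper discretisation of time with mesh `1 / (m + 1)`. -/
noncomputable def discretize (m : ℕ) (t : ℝ≥0) : ℝ≥0 :=
  (⌊((m : ℝ≥0) + 1) * t⌋₊ + 1) / ((m : ℝ≥0) + 1)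

/-- The `+ 1` in the numerator keeps the grid point positive even at `t = 0`, since self-similarity
is assumed only for `c > 0`. It also places the point to the right of `t`, as right-continuity
requires. -/
theorem discretize_pos (m : ℕ) (t : ℝ≥0) : 0 < discretize m t := by
  unfold discretize
  positivity

theorem le_discretize (m : ℕ) (t : ℝ≥0) : t ≤ discretize m t := by
  unfold discretize
  rw [le_div_iff₀ (by positivity), mul_comm]
  exact (Nat.lt_floor_add_one _).le

theorem discretize_le (m : ℕ) (t : ℝ≥0) : discretize m t ≤ t + 1 / ((m : ℝ≥0) + 1) := by
  unfold discretize
  rw [add_div]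
  gcongr
  rw [div_le_iff₀ (by positivity), mul_comm]
  exact Nat.floor_le (by positivity)

theorem tendsto_discretize (t : ℝ≥0) :
    Tendsto (fun m => discretize m t) atTop (𝓝[≥] t) := by
  refine tendsto_nhdsWithin_iff.2 ⟨?_, Eventually.of_forall fun m => le_discretize m t⟩
  refine tendsto_of_tendsto_of_tendsto_of_le_of_le tendsto_const_nhds ?_
    (fun m => le_discretize m t) (fun m => discretize_le m t)
  have : Tendsto (fun m : ℕ => 1 / ((m : ℝ≥0) + 1)) atTop (𝓝 0) :=
    tendsto_one_div_add_atTop_nhds_zero_nat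
  simpa using this.const_add t

/-- Evaluation of an arbitrary path at a varying time need not be jointly measurable; a countable
grid reduces it to coordinate projections. -/
theorem measurable_eval_discretize (m : ℕ) :
    Measurable (fun q : ℝ≥0 × (ℝ≥0 → ℝ) => q.2 (discretize m q.1)) := by
  have h1 : Measurable (fun q : ℕ × (ℝ≥0 → ℝ) =>
      q.2 (((q.1 : ℝ≥0) + 1) / ((m : ℝ≥0) + 1))) :=
    measurable_from_prod_countable_right fun k =>
      measurable_pi_apply (((k : ℝ≥0) + 1) / ((m : ℝ≥0) + 1))
  have h2 : Measurable (fun q : ℝ≥0 × (ℝ≥0 → ℝ) => (⌊((m : ℝ≥0) + 1) * q.1⌋₊, q.2)) :=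
    Measurable.prodMk (Nat.measurable_floor.comp (measurable_fst.const_mul _)) measurable_snd
  exact h1.comp h2

theorem measurable_discretize (m : ℕ) : Measurable (discretize m) := by
  unfold discretize
  have : Measurable fun t : ℝ≥0 => ⌊((m : ℝ≥0) + 1) * t⌋₊ :=
    Nat.measurable_floor.comp (measurable_id.const_mul _)
  fun_prop

variable {Ω : Type*} [MeasurableSpace Ω] {P : Measure Ω}

theorem IsCadlag.tendsto_discretize {y : ℝ≥0 → ℝ} (hy : IsCadlag y) (t : ℝ≥0) :
    Tendsto (fun m => y (discretize m t)) atTop (𝓝 (y t)) :=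
  (hy t).1.tendsto.comp (_root_.tendsto_discretize t)

theorem measurable_timeChange_discretize {Y : ℝ≥0 → Ω → ℝ} (hYmeas : ∀ t, Measurable (Y t))
    {T : Ω → ℝ≥0} (hTmeas : Measurable T) (m : ℕ) :
    Measurable (fun ω => Y (discretize m (T ω)) ω) :=
  (measurable_eval_discretize m).comp (hTmeas.prodMk (measurable_pi_lambda _ hYmeas))

theorem measurable_timeChange {Y : ℝ≥0 → Ω → ℝ} (hYmeas : ∀ t, Measurable (Y t))
    (hYcadlag : ∀ ω, IsCadlag (fun t => Y t ω)) {T : Ω → ℝ≥0} (hTmeas : Measurable T) :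
    Measurable (fun ω => Y (T ω) ω) :=
  measurable_of_tendsto_metrizable (measurable_timeChange_discretize hYmeas hTmeas)
    (tendsto_pi_nhds.2 fun ω => (hYcadlag ω).tendsto_discretize (T ω))

theorem IsSelfSimilar.map_eq {H : ℝ} {Y : ℝ≥0 → Ω → ℝ} (hYss : IsSelfSimilar P H Y)
    (hYmeas : ∀ t, Measurable (Y t)) {t : ℝ≥0} (ht : 0 < t) :
    P.map (Y t) = (P.map (Y 1)).map (fun z => (t : ℝ) ^ H * z) := by
  have h := hYss t ht {1}
  have h1 := congrArg (Measure.map (fun p : ({1} : Finset ℝ≥0) → ℝ =>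
    p ⟨1, Finset.mem_singleton_self 1⟩)) h
  rw [Measure.map_map (measurable_pi_apply _) (measurable_pi_lambda _ fun i => hYmeas _),
    Measure.map_map (measurable_pi_apply _)
      (measurable_pi_lambda _ fun i => (hYmeas _).const_mul _)] at h1
  rw [Measure.map_map (measurable_const_mul _) (hYmeas 1)]
  simpa [Function.comp_def] using h1

/-- Independence and Fubini freeze the time, after which only the one-dimensional marginal at a
positive grid point matters. -/
theorem integral_timeChange_discretize [IsProbabilityMeasure P] {H : ℝ} {Y : ℝ≥0 → Ω → ℝ}
    (hYss : IsSelfSimilar P H Y) (hYmeas : ∀ t, Measurable (Y t)) {T : Ω → ℝ≥0}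
    (hTmeas : Measurable T) (hTY : IndepFun T (fun ω t => Y t ω) P)
    (h : BoundedContinuousFunction ℝ ℝ) (m : ℕ) :
    ∫ ω, h (Y (discretize m (T ω)) ω) ∂P =
      ∫ q : ℝ≥0 × ℝ, h ((discretize m q.1 : ℝ) ^ H * q.2) ∂((P.map T).prod (P.map (Y 1))) := by
  have hpath : Measurable (fun ω t => Y t ω) := measurable_pi_lambda _ hYmeas
  have : IsProbabilityMeasure (P.map T) := Measure.isProbabilityMeasure_map hTmeas.aemeasurable
  have : IsProbabilityMeasure (P.map (Y 1)) :=
    Measure.isProbabilityMeasure_map (hYmeas 1).aemeasurable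
  have : IsProbabilityMeasure (P.map fun ω t => Y t ω) :=
    Measure.isProbabilityMeasure_map hpath.aemeasurable
  have hjoint := (indepFun_iff_map_prod_eq_prod_map_map hTmeas.aemeasurable
    hpath.aemeasurable).1 hTY
  have hΦ : Measurable (fun q : ℝ≥0 × (ℝ≥0 → ℝ) => h (q.2 (discretize m q.1))) :=
    h.continuous.measurable.comp (measurable_eval_discretize m)
  have hΨ : Measurable (fun q : ℝ≥0 × ℝ => h ((discretize m q.1 : ℝ) ^ H * q.2)) := by
    have := measurable_discretize m
    refine h.continuous.measurable.comp ?_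
    fun_prop
  have hb : ∀ x, ‖h x‖ ≤ ‖h‖ := h.norm_coe_le_norm
  calc ∫ ω, h (Y (discretize m (T ω)) ω) ∂P
      = ∫ q, h (q.2 (discretize m q.1)) ∂(P.map fun ω => (T ω, fun t => Y t ω)) := by
        rw [integral_map (hTmeas.prodMk hpath).aemeasurable hΦ.aestronglyMeasurable]
    _ = ∫ t, ∫ p, h (p (discretize m t)) ∂(P.map fun ω t => Y t ω) ∂(P.map T) := by
        rw [hjoint, integral_prod]
        exact Integrable.of_bound hΦ.aestronglyMeasurable ‖h‖ (ae_of_all _ fun q => hb _)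
    _ = ∫ t, ∫ z, h ((discretize m t : ℝ) ^ H * z) ∂(P.map (Y 1)) ∂(P.map T) := by
        congr 1
        ext t
        have hm : Measurable fun p : ℝ≥0 → ℝ => h (p (discretize m t)) :=
          h.continuous.measurable.comp (measurable_pi_apply _)
        rw [integral_map hpath.aemeasurable hm.aestronglyMeasurable,
          ← integral_map (φ := Y (discretize m t)) (f := h) (hYmeas _).aemeasurable
            h.continuous.aestronglyMeasurable, hYss.map_eq hYmeas (discretize_pos m t),
          integral_map (measurable_const_mul _).aemeasurable h.continuous.aestronglyMeasurable]
    _ = _ := by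
        rw [integral_prod]
        exact Integrable.of_bound hΨ.aestronglyMeasurable ‖h‖ (ae_of_all _ fun q => hb _)

/-- The law of a self-similar process at an independent time. -/
theorem map_timeChange [IsProbabilityMeasure P] {H : ℝ} (hH : 0 < H) {Y : ℝ≥0 → Ω → ℝ}
    (hYss : IsSelfSimilar P H Y) (hYmeas : ∀ t, Measurable (Y t))
    (hYcadlag : ∀ ω, IsCadlag (fun t => Y t ω)) {T : Ω → ℝ≥0}
    (hTmeas : Measurable T) (hTY : IndepFun T (fun ω t => Y t ω) P) :
    P.map (fun ω => Y (T ω) ω) =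
      ((P.map T).prod (P.map (Y 1))).map (fun q => (q.1 : ℝ) ^ H * q.2) := by
  have : IsProbabilityMeasure (P.map T) := Measure.isProbabilityMeasure_map hTmeas.aemeasurable
  have : IsProbabilityMeasure (P.map (Y 1)) :=
    Measure.isProbabilityMeasure_map (hYmeas 1).aemeasurable
  have hYT := measurable_timeChange hYmeas hYcadlag hTmeas
  have hm : Measurable (fun q : ℝ≥0 × ℝ => (q.1 : ℝ) ^ H * q.2) := by fun_prop
  refine ext_of_forall_integral_eq_of_IsFiniteMeasure fun h => ?_
  rw [integral_map hYT.aemeasurable h.continuous.aestronglyMeasurable,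
    integral_map hm.aemeasurable h.continuous.aestronglyMeasurable]
  have hb : ∀ x, ‖h x‖ ≤ ‖h‖ := h.norm_coe_le_norm
  -- Both sides of the discretised identity converge by dominated convergence: this one by
  -- right-continuity of paths, the other by continuity of `t ↦ t ^ H`.
  have h1 : Tendsto (fun m => ∫ ω, h (Y (discretize m (T ω)) ω) ∂P) atTop
      (𝓝 (∫ ω, h (Y (T ω) ω) ∂P)) := by
    refine tendsto_integral_of_dominated_convergence (fun _ => ‖h‖) (fun m => ?_)
      (integrable_const _) (fun m => ae_of_all _ fun ω => hb _) (ae_of_all _ fun ω => ?_)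
    · exact (h.continuous.measurable.comp
        (measurable_timeChange_discretize hYmeas hTmeas m)).aestronglyMeasurable
    · exact (h.continuous.tendsto _).comp ((hYcadlag ω).tendsto_discretize (T ω))
  have h2 : Tendsto (fun m => ∫ q : ℝ≥0 × ℝ, h ((discretize m q.1 : ℝ) ^ H * q.2)
      ∂((P.map T).prod (P.map (Y 1)))) atTop
      (𝓝 (∫ q : ℝ≥0 × ℝ, h ((q.1 : ℝ) ^ H * q.2) ∂((P.map T).prod (P.map (Y 1))))) := by
    refine tendsto_integral_of_dominated_convergence (fun _ => ‖h‖) (fun m => ?_)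
      (integrable_const _) (fun m => ae_of_all _ fun ω => hb _) (ae_of_all _ fun q => ?_)
    · have := measurable_discretize m
      refine (h.continuous.measurable.comp ?_).aestronglyMeasurable
      fun_prop
    · have h3 : Tendsto (fun m => discretize m q.1) atTop (𝓝 q.1) :=
        (tendsto_discretize q.1).mono_right nhdsWithin_le_nhds
      have h4 : Tendsto (fun m => (discretize m q.1 : ℝ)) atTop (𝓝 (q.1 : ℝ)) :=
        (NNReal.continuous_coe.tendsto _).comp h3
      exact (h.continuous.tendsto _).comp ((h4.rpow_const (Or.inr hH.le)).mul_const q.2)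
  simp_rw [integral_timeChange_discretize hYss hYmeas hTmeas hTY h] at h1
  exact tendsto_nhds_unique h1 h2

end TimeChange

/-! ### Mean squared error of a complex sample mean -/

section SampleMean

variable {Ω : Type*} [MeasurableSpace Ω] {P : Measure Ω} [IsProbabilityMeasure P]

theorem integral_sq_sampleMean_sub_le {W : ℕ → Ω → ℝ} {μ V : ℝ} (hW : ∀ k, MemLp (W k) 2 P)
    (hindep : Pairwise fun i j => IndepFun (W i) (W j) P) (hmean : ∀ k, ∫ ω, W k ω ∂P = μ)
    (hV : ∀ k, ∫ ω, W k ω ^ 2 ∂P ≤ V) {n : ℕ} (hn : 0 < n) :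
    Integrable (fun ω => ((1 / n) * ∑ k ∈ Finset.range n, W k ω - μ) ^ 2) P ∧
      ∫ ω, ((1 / n) * ∑ k ∈ Finset.range n, W k ω - μ) ^ 2 ∂P ≤ V / n := by
  have hn' : (0 : ℝ) < n := by exact_mod_cast hn
  have hS : MemLp (∑ k ∈ Finset.range n, W k) 2 P := memLp_finsetSum' _ fun k _ => hW k
  have hmeanS : ∫ ω, (∑ k ∈ Finset.range n, W k) ω ∂P = n * μ := by
    simp_rw [Finset.sum_apply]
    rw [integral_finsetSum _ fun k _ => (hW k).integrable (by norm_num)]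
    simp [hmean]
  have hpt : ∀ ω, ((1 / n) * ∑ k ∈ Finset.range n, W k ω - μ) ^ 2 =
      (1 / n) ^ 2 * ((∑ k ∈ Finset.range n, W k) ω - n * μ) ^ 2 := by
    intro ω
    rw [Finset.sum_apply]
    field_simp
  have hvar := IndepFun.variance_sum (s := Finset.range n) (fun k _ => hW k)
    (fun i _ j _ hij => hindep hij)
  rw [variance_eq_integral hS.aestronglyMeasurable.aemeasurable, hmeanS] at hvar
  simp_rw [hpt]
  constructor
  · exact ((hS.sub (memLp_const _)).integrable_sq).const_mul _
  · rw [integral_const_mul, hvar]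
    have h1 : ∑ k ∈ Finset.range n, variance (W k) P ≤ n * V := by
      refine (Finset.sum_le_card_nsmul _ _ V fun k _ => ?_).trans_eq (by simp)
      exact (variance_le_expectation_sq (hW k).aestronglyMeasurable).trans (hV k)
    calc (1 / (n : ℝ)) ^ 2 * ∑ k ∈ Finset.range n, variance (W k) P
        ≤ (1 / (n : ℝ)) ^ 2 * (n * V) := by gcongr
      _ = V / n := by field_simp

/-- Bias-variance bound for the mean squared error of a sample mean. -/
theorem mse_sampleMean_le {Z : ℕ → Ω → ℂ} {m : ℂ} {V : ℝ} (hZ : ∀ k, MemLp (Z k) 2 P)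
    (hindep : iIndepFun Z P) (hmean : ∀ k, ∫ ω, Z k ω ∂P = m)
    (hV : ∀ k, ∫ ω, ‖Z k ω‖ ^ 2 ∂P ≤ V) {n : ℕ} (hn : 0 < n) (θ : ℝ) :
    mse P θ (fun ω => (1 / (n : ℂ)) * ∑ k ∈ Finset.range n, Z k ω) ≤
      ENNReal.ofReal (2 * ‖(θ : ℂ) - m‖ ^ 2 + 4 * (V / n)) := by
  have hint : ∀ k, Integrable (Z k) P := fun k => (hZ k).integrable (by norm_num)
  have hsq : ∀ k, Integrable (fun ω => ‖Z k ω‖ ^ 2) P := fun k => (hZ k).norm.integrable_sq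
  have hre := integral_sq_sampleMean_sub_le (W := fun k ω => (Z k ω).re) (μ := m.re) (V := V)
    (fun k => (hZ k).re) (fun i j hij =>
      (hindep.indepFun hij).comp Complex.measurable_re Complex.measurable_re)
    (fun k => by rw [← hmean k]; exact integral_re (hint k))
    (fun k => (integral_mono (hZ k).re.integrable_sq (hsq k) fun ω => by
      have := Complex.abs_re_le_norm (Z k ω)
      exact sq_le_sq.2 (by simpa using this)).trans (hV k)) hn
  have him := integral_sq_sampleMean_sub_le (W := fun k ω => (Z k ω).im) (μ := m.im) (V := V)
    (fun k => (hZ k).im) (fun i j hij =>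
      (hindep.indepFun hij).comp Complex.measurable_im Complex.measurable_im)
    (fun k => by rw [← hmean k]; exact integral_im (hint k))
    (fun k => (integral_mono (hZ k).im.integrable_sq (hsq k) fun ω => by
      have := Complex.abs_im_le_norm (Z k ω)
      exact sq_le_sq.2 (by simpa using this)).trans (hV k)) hn
  set A : Ω → ℝ := fun ω => ((1 / n) * ∑ k ∈ Finset.range n, (Z k ω).re - m.re) ^ 2 with hA
  set B : Ω → ℝ := fun ω => ((1 / n) * ∑ k ∈ Finset.range n, (Z k ω).im - m.im) ^ 2 with hB
  -- The cross term is absorbed by `(p + q)² ≤ 2p² + 2q²`. Real and imaginary parts each have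
  -- variance at most `V / n`, hence the factor `4`.
  have hpt : ∀ ω, ‖(θ : ℂ) - (1 / (n : ℂ)) * ∑ k ∈ Finset.range n, Z k ω‖ ^ 2 ≤
      2 * ‖(θ : ℂ) - m‖ ^ 2 + 2 * (A ω + B ω) := by
    intro ω
    set S := (1 / (n : ℂ)) * ∑ k ∈ Finset.range n, Z k ω with hS
    have h1 : ‖S - m‖ ^ 2 = A ω + B ω := by
      have hcast : (1 / (n : ℂ)) = ((1 / n : ℝ) : ℂ) := by push_cast; rfl
      rw [← Complex.normSq_eq_norm_sq, Complex.normSq_apply, Complex.sub_re, Complex.sub_im, hS,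
        hcast, Complex.re_ofReal_mul, Complex.im_ofReal_mul, Complex.re_sum, Complex.im_sum, hA, hB]
      ring
    rw [← h1]
    have h2 : ‖(θ : ℂ) - S‖ ≤ ‖(θ : ℂ) - m‖ + ‖S - m‖ := by
      rw [← norm_neg (S - m)]
      refine (norm_add_le _ _).trans_eq' ?_
      congr 1
      ring
    nlinarith [norm_nonneg ((θ : ℂ) - S), sq_nonneg (‖(θ : ℂ) - m‖ - ‖S - m‖)]
  have hAB : Integrable (fun ω => 2 * (A ω + B ω)) P := (hre.1.add him.1).const_mul 2
  have hint2 : Integrable (fun ω => 2 * ‖(θ : ℂ) - m‖ ^ 2 + 2 * (A ω + B ω)) P :=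
    (integrable_const _).add hAB
  calc mse P θ (fun ω => (1 / (n : ℂ)) * ∑ k ∈ Finset.range n, Z k ω)
      ≤ ∫⁻ ω, ENNReal.ofReal (2 * ‖(θ : ℂ) - m‖ ^ 2 + 2 * (A ω + B ω)) ∂P := by
        refine lintegral_mono fun ω => ?_
        rw [← ofReal_norm, ← ENNReal.ofReal_pow (norm_nonneg _)]
        exact ENNReal.ofReal_le_ofReal (hpt ω)
    _ = ENNReal.ofReal (∫ ω, (2 * ‖(θ : ℂ) - m‖ ^ 2 + 2 * (A ω + B ω)) ∂P) := by
        rw [ofReal_integral_eq_lintegral_ofReal hint2 (ae_of_all _ fun ω => by positivity)]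
    _ ≤ _ := by
        refine ENNReal.ofReal_le_ofReal ?_
        rw [integral_add (integrable_const _) hAB, integral_const_mul 2 fun ω => A ω + B ω,
          integral_add hre.1 him.1]
        simp only [integral_const, probReal_univ, one_smul]
        linarith [hre.2, him.2]

end SampleMean

/-! ### Factorisation of the moments of an observation -/

section Moments

/-- Equality can fail at `r = 0`: for nonzero purely imaginary `w` the left side is `0` and the
right side is `1`. -/
theorem norm_ofReal_cpow_le {r : ℝ} (hr : 0 ≤ r) (w : ℂ) : ‖(r : ℂ) ^ w‖ ≤ r ^ w.re := by
  rcases hr.eq_or_lt with rfl | hr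
  · rcases eq_or_ne w 0 with rfl | hw
    · simp
    · rw [Complex.ofReal_zero, Complex.zero_cpow hw, norm_zero]
      positivity
  · exact (Complex.norm_cpow_eq_rpow_re_of_pos hr w).le

theorem ofReal_rpow_cpow {r H : ℝ} (hr : 0 ≤ r) (hH : H ≠ 0) (w : ℂ) :
    ((r ^ H : ℝ) : ℂ) ^ w = (r : ℂ) ^ ((H : ℂ) * w) := by
  rcases hr.eq_or_lt with rfl | hr
  · rw [Real.zero_rpow hH, Complex.ofReal_zero]
    rcases eq_or_ne w 0 with rfl | hw
    · simp
    · rw [Complex.zero_cpow hw, Complex.zero_cpow (mul_ne_zero (by exact_mod_cast hH) hw)]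
  · rw [Complex.cpow_def_of_ne_zero (by exact_mod_cast (Real.rpow_pos_of_pos hr H).ne'),
      Complex.cpow_def_of_ne_zero (by exact_mod_cast hr.ne'), ← Complex.ofReal_log hr.le,
      ← Complex.ofReal_log (by positivity), Real.log_rpow hr]
    push_cast
    ring_nf

variable {Ω : Type*} [MeasurableSpace Ω] {P : Measure Ω}

theorem HasDensity.integral_cpow {T : Ω → ℝ≥0} (hT : Measurable T) {f : ℝ → ℝ}
    (hf : HasDensity P T f) (hmeas : AEMeasurable f (volume.restrict (Ioi 0))) (w : ℂ) :
    ∫ t, ((t : ℝ) : ℂ) ^ w ∂(P.map T) = mellin (fun x => (f x : ℂ)) (w + 1) := by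
  have hm : Measurable fun t : ℝ => (t : ℂ) ^ w := by fun_prop
  have hm' : Measurable fun t : ℝ≥0 => ((t : ℝ) : ℂ) ^ w := hm.comp measurable_coe_nnreal_real
  rw [integral_map hT.aemeasurable hm'.aestronglyMeasurable,
    ← integral_map (φ := fun ω => (T ω : ℝ)) (f := fun t : ℝ => (t : ℂ) ^ w)
      (measurable_coe_nnreal_real.comp hT).aemeasurable hm.aestronglyMeasurable, hf.2,
    integral_withDensity_eq_integral_toReal_smul₀ hmeas.ennreal_ofReal (by simp), mellin]
  refine setIntegral_congr_fun measurableSet_Ioi fun x hx => ?_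
  simp only [ENNReal.toReal_ofReal (hf.1 x hx), add_sub_cancel_right, Complex.real_smul,
    smul_eq_mul]
  ring

theorem HasDensity.integrable_rpow {T : Ω → ℝ≥0} (hT : Measurable T) {f : ℝ → ℝ}
    (hf : HasDensity P T f) (hmeas : AEMeasurable f (volume.restrict (Ioi 0))) {a b p : ℝ}
    (hM : MellinClass a b f) (hp : p + 1 ∈ Ioo a b) :
    Integrable (fun t : ℝ≥0 => (t : ℝ) ^ p) (P.map T) := by
  have hm : Measurable fun t : ℝ => t ^ p := by fun_prop
  have hm' : Measurable fun t : ℝ≥0 => (t : ℝ) ^ p := hm.comp measurable_coe_nnreal_real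
  rw [integrable_map_measure hm'.aestronglyMeasurable hT.aemeasurable]
  have h1 : Integrable (fun t : ℝ => t ^ p) (P.map fun ω => (T ω : ℝ)) := by
    rw [hf.2, integrable_withDensity_iff_integrable_smul₀' hmeas.ennreal_ofReal (by simp)]
    refine (hM _ hp).congr_fun (fun x hx => ?_) measurableSet_Ioi
    simp only [ENNReal.toReal_ofReal (hf.1 x hx), smul_eq_mul, add_sub_cancel_right]
  exact (integrable_map_measure hm.aestronglyMeasurable
    (measurable_coe_nnreal_real.comp hT).aemeasurable).1 h1

theorem ClassC.aemeasurable {β a b : ℝ} (hβ : 0 ≤ β) {f : ℝ → ℝ} (hf : ClassC β a b f) :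
    AEMeasurable f (volume.restrict (Ioi 0)) := by
  obtain ⟨-, F, hF, hFf, -, -⟩ := hf
  refine ContinuousOn.aemeasurable ?_ measurableSet_Ioi
  have h1 : ContinuousOn (fun x : ℝ => (F x).re) (Ioi 0) := by
    refine Complex.continuous_re.comp_continuousOn
      (hF.continuousOn.comp Complex.continuous_ofReal.continuousOn fun x hx => ?_)
    refine ⟨by exact_mod_cast (mem_Ioi.1 hx).ne', ?_⟩
    rw [Complex.arg_ofReal_of_nonneg (mem_Ioi.1 hx).le, abs_zero]
    exact hβ
  exact h1.congr fun x hx => by simp only [hFf x hx, Complex.ofReal_re]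

/-- Moments of a random variable with the law of `T ^ H * Z`, for independent `T` and `Z`. -/
theorem integral_abs_cpow_of_map_eq {Ω' : Type*} [MeasurableSpace Ω'] {P' : Measure Ω'}
    [IsProbabilityMeasure P] {H : ℝ} (hH : 0 < H) {T : Ω → ℝ≥0} (hT : Measurable T) {Z : Ω → ℝ}
    (hZ : Measurable Z) {f : ℝ → ℝ} (hf : HasDensity P T f)
    (hmeas : AEMeasurable f (volume.restrict (Ioi 0))) {X : Ω' → ℝ} (hX : AEMeasurable X P')
    (hlaw : P'.map X = ((P.map T).prod (P.map Z)).map (fun q => (q.1 : ℝ) ^ H * q.2)) (w : ℂ) :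
    ∫ ω, ((|X ω| : ℝ) : ℂ) ^ w ∂P' =
      mellin (fun x => (f x : ℂ)) (H * w + 1) * absMellin P Z (w + 1) := by
  have : IsProbabilityMeasure (P.map T) := Measure.isProbabilityMeasure_map hT.aemeasurable
  have : IsProbabilityMeasure (P.map Z) := Measure.isProbabilityMeasure_map hZ.aemeasurable
  have hm : Measurable fun y : ℝ => ((|y| : ℝ) : ℂ) ^ w := by fun_prop
  have hprod : Measurable (fun q : ℝ≥0 × ℝ => (q.1 : ℝ) ^ H * q.2) := by fun_prop
  have hpt : ∀ q : ℝ≥0 × ℝ, ((|(q.1 : ℝ) ^ H * q.2| : ℝ) : ℂ) ^ w =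
      ((q.1 : ℝ) : ℂ) ^ ((H : ℂ) * w) * ((|q.2| : ℝ) : ℂ) ^ w := by
    intro q
    have h0 : (0 : ℝ) ≤ (q.1 : ℝ) ^ H := by positivity
    rw [abs_mul, abs_of_nonneg h0, Complex.ofReal_mul,
      Complex.mul_cpow_ofReal_nonneg h0 (abs_nonneg _), ofReal_rpow_cpow q.1.coe_nonneg hH.ne']
  rw [← integral_map (φ := X) (f := fun y => ((|y| : ℝ) : ℂ) ^ w) hX hm.aestronglyMeasurable, hlaw,
    integral_map hprod.aemeasurable hm.aestronglyMeasurable]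
  simp_rw [hpt]
  rw [integral_prod_mul (fun t : ℝ≥0 => ((t : ℝ) : ℂ) ^ ((H : ℂ) * w))
    (fun z : ℝ => ((|z| : ℝ) : ℂ) ^ w), hf.integral_cpow hT hmeas,
    integral_map hZ.aemeasurable hm.aestronglyMeasurable, absMellin, add_sub_cancel_right]

theorem integrable_abs_rpow_of_map_eq {Ω' : Type*} [MeasurableSpace Ω'] {P' : Measure Ω'}
    [IsProbabilityMeasure P] {H : ℝ} {T : Ω → ℝ≥0} (hT : Measurable T) {Z : Ω → ℝ}
    (hZ : HasLaw Z (gaussianReal 0 1) P) {f : ℝ → ℝ} (hf : HasDensity P T f)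
    (hmeas : AEMeasurable f (volume.restrict (Ioi 0))) {X : Ω' → ℝ} (hX : AEMeasurable X P')
    (hlaw : P'.map X = ((P.map T).prod (P.map Z)).map (fun q => (q.1 : ℝ) ^ H * q.2))
    {a b p : ℝ} (hM : MellinClass a b f) (hp : H * p + 1 ∈ Ioo a b) (hp' : -1 < p) :
    Integrable (fun ω => |X ω| ^ p) P' := by
  have : IsProbabilityMeasure (P.map T) := Measure.isProbabilityMeasure_map hT.aemeasurable
  have hm : Measurable fun y : ℝ => |y| ^ p := by fun_prop
  have hprod : Measurable (fun q : ℝ≥0 × ℝ => (q.1 : ℝ) ^ H * q.2) := by fun_prop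
  have h1 : Integrable (fun y : ℝ => |y| ^ p) (P'.map X) := by
    rw [hlaw, integrable_map_measure hm.aestronglyMeasurable hprod.aemeasurable, hZ.map_eq]
    refine ((hf.integrable_rpow hT hmeas hM hp).mul_prod
      (integrable_abs_rpow_gaussianReal hp')).congr (ae_of_all _ fun q => ?_)
    simp only [Function.comp_apply]
    have h0 : (0 : ℝ) ≤ (q.1 : ℝ) ^ H := by positivity
    rw [abs_mul, abs_of_nonneg h0, Real.mul_rpow h0 (abs_nonneg _), ← Real.rpow_mul q.1.coe_nonneg]
  exact (integrable_map_measure hm.aestronglyMeasurable hX).1 h1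

end Moments

/-! ### The estimator as a sample mean of kernels -/

section Kernel

/-- The contribution of a single observation `y` to the estimator. -/
noncomputable def estimatorKernel (H γ : ℝ) (M : ℂ → ℂ) (g x y : ℝ) : ℂ :=
  (1 / (2 * (Real.pi : ℂ))) * ∫ v in (-g)..g,
    ((|y| : ℝ) : ℂ) ^ (((γ : ℂ) + H - 1 + v * Complex.I) / H - 1) /
      M (((γ : ℂ) + H - 1 + v * Complex.I) / H) * (x : ℂ) ^ (-(γ : ℂ) - v * Complex.I)

variable {H γ : ℝ} {M : ℂ → ℂ}

/-- The bound separates `y` from `v`; this justifies Fubini and reduces the variance to one moment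
of the observation and one integral of `1 / |M|`. -/
theorem norm_kernel_integrand_le (hH : 0 < H) {x : ℝ} (hx : 0 < x) (y v : ℝ) :
    ‖((|y| : ℝ) : ℂ) ^ (((γ : ℂ) + H - 1 + v * Complex.I) / H - 1) /
      M (((γ : ℂ) + H - 1 + v * Complex.I) / H) * (x : ℂ) ^ (-(γ : ℂ) - v * Complex.I)‖ ≤
    |y| ^ ((γ - 1) / H) * (‖(M (((γ : ℂ) + H - 1 + v * Complex.I) / H))⁻¹‖ * x ^ (-γ)) := by
  rw [div_eq_mul_inv, norm_mul, norm_mul, mul_assoc, Complex.norm_cpow_eq_rpow_re_of_pos hx]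
  have h1 : (-(γ : ℂ) - v * Complex.I).re = -γ := by simp
  have h2 : (((γ : ℂ) + H - 1 + v * Complex.I) / H - 1).re = (γ - 1) / H := by
    rw [Complex.sub_re, re_mellinLine, Complex.one_re]
    field_simp
    ring
  have h3 := norm_ofReal_cpow_le (abs_nonneg y) (((γ : ℂ) + H - 1 + v * Complex.I) / H - 1)
  rw [h2] at h3
  rw [h1]
  gcongr

theorem measurable_kernel_integrand
    (hM : Continuous fun v : ℝ => M (((γ : ℂ) + H - 1 + v * Complex.I) / H)) (x : ℝ) :
    Measurable fun q : ℝ × ℝ =>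
      ((|q.1| : ℝ) : ℂ) ^ (((γ : ℂ) + H - 1 + q.2 * Complex.I) / H - 1) /
        M (((γ : ℂ) + H - 1 + q.2 * Complex.I) / H) *
          (x : ℂ) ^ (-(γ : ℂ) - q.2 * Complex.I) := by
  have h1 : Measurable fun q : ℝ × ℝ => M (((γ : ℂ) + H - 1 + q.2 * Complex.I) / H) :=
    hM.measurable.comp measurable_snd
  exact Measurable.mul (Measurable.div (by fun_prop) h1) (by fun_prop)

theorem continuous_norm_inv (hM : Continuous fun v : ℝ => M (((γ : ℂ) + H - 1 + v * Complex.I) / H))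
    (hM0 : ∀ v : ℝ, M (((γ : ℂ) + H - 1 + v * Complex.I) / H) ≠ 0) :
    Continuous fun v : ℝ => ‖(M (((γ : ℂ) + H - 1 + v * Complex.I) / H))⁻¹‖ :=
  (hM.inv₀ hM0).norm

theorem intervalIntegrable_kernel (hH : 0 < H)
    (hM : Continuous fun v : ℝ => M (((γ : ℂ) + H - 1 + v * Complex.I) / H))
    (hM0 : ∀ v : ℝ, M (((γ : ℂ) + H - 1 + v * Complex.I) / H) ≠ 0) {x : ℝ} (hx : 0 < x)
    (y c d : ℝ) :
    IntervalIntegrable (fun v : ℝ =>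
      ((|y| : ℝ) : ℂ) ^ (((γ : ℂ) + H - 1 + v * Complex.I) / H - 1) /
        M (((γ : ℂ) + H - 1 + v * Complex.I) / H) * (x : ℂ) ^ (-(γ : ℂ) - v * Complex.I))
      volume c d := by
  have hb : IntervalIntegrable (fun v : ℝ => |y| ^ ((γ - 1) / H) *
      (‖(M (((γ : ℂ) + H - 1 + v * Complex.I) / H))⁻¹‖ * x ^ (-γ))) volume c d :=
    (continuous_const.mul ((continuous_norm_inv hM hM0).mul continuous_const)).intervalIntegrable _ _
  exact hb.mono_fun' ((measurable_kernel_integrand hM x).comp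
    measurable_prodMk_left).aestronglyMeasurable (ae_of_all _ fun v => norm_kernel_integrand_le hH hx y v)

theorem measurable_estimatorKernel
    (hM : Continuous fun v : ℝ => M (((γ : ℂ) + H - 1 + v * Complex.I) / H)) {g : ℝ} (hg : 0 ≤ g)
    (x : ℝ) : Measurable (estimatorKernel H γ M g x) := by
  unfold estimatorKernel
  simp_rw [intervalIntegral.integral_of_le (show -g ≤ g by linarith)]
  exact ((measurable_kernel_integrand hM x).stronglyMeasurable.integral_prod_right
    (ν := volume.restrict (Ioc (-g) g))).measurable.const_mul _

theorem norm_one_div_two_pi : ‖(1 / (2 * (Real.pi : ℂ)))‖ = 1 / (2 * Real.pi) := by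
  rw [norm_div, norm_mul, Complex.norm_real, Real.norm_of_nonneg Real.pi_pos.le]
  simp

theorem norm_estimatorKernel_le (hH : 0 < H)
    (hM : Continuous fun v : ℝ => M (((γ : ℂ) + H - 1 + v * Complex.I) / H))
    (hM0 : ∀ v : ℝ, M (((γ : ℂ) + H - 1 + v * Complex.I) / H) ≠ 0) {g x : ℝ} (hg : 0 ≤ g)
    (hx : 0 < x) (y : ℝ) :
    ‖estimatorKernel H γ M g x y‖ ≤ x ^ (-γ) * |y| ^ ((γ - 1) / H) *
      ∫ v in (-g)..g, ‖(M (((γ : ℂ) + H - 1 + v * Complex.I) / H))⁻¹‖ := by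
  have hc := continuous_norm_inv hM hM0
  rw [estimatorKernel, norm_mul, norm_one_div_two_pi]
  have h1 : (1 : ℝ) / (2 * Real.pi) ≤ 1 := by
    rw [div_le_one (by positivity)]
    linarith [Real.pi_gt_three]
  refine (mul_le_of_le_one_left (norm_nonneg _) h1).trans ?_
  refine (intervalIntegral.norm_integral_le_of_norm_le (show -g ≤ g by linarith)
    (ae_of_all _ fun v _ => norm_kernel_integrand_le hH hx y v)
    ((continuous_const.mul (hc.mul continuous_const)).intervalIntegrable _ _)).trans_eq ?_
  rw [intervalIntegral.integral_const_mul, intervalIntegral.integral_mul_const]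
  ring

theorem estimator_eq_sum_kernel (hH : 0 < H)
    (hM : Continuous fun v : ℝ => M (((γ : ℂ) + H - 1 + v * Complex.I) / H))
    (hM0 : ∀ v : ℝ, M (((γ : ℂ) + H - 1 + v * Complex.I) / H) ≠ 0) {x : ℝ} (hx : 0 < x)
    (g : ℝ) (n : ℕ) (obs : ℕ → ℝ) :
    estimator H γ M g n obs x =
      (1 / (n : ℂ)) * ∑ k ∈ Finset.range n, estimatorKernel H γ M g x (obs k) := by
  unfold estimator estimatorKernel empMellin
  rw [← Finset.mul_sum, ← intervalIntegral.integral_finsetSum fun k _ =>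
    intervalIntegrable_kernel hH hM hM0 hx (obs k) (-g) g, mul_left_comm,
    ← intervalIntegral.integral_const_mul (1 / (n : ℂ))]
  congr 2
  ext v
  rw [Finset.mul_sum, Finset.sum_div, Finset.sum_mul, Finset.mul_sum]
  refine Finset.sum_congr rfl fun k _ => ?_
  ring

/-- After Fubini the factor `M` of the moment cancels the denominator, so the mean of the kernel is
exactly the truncated Mellin inversion. -/
theorem integral_estimatorKernel {Ω : Type*} [MeasurableSpace Ω] {P : Measure Ω}
    [IsProbabilityMeasure P] (hH : 0 < H)
    (hM : Continuous fun v : ℝ => M (((γ : ℂ) + H - 1 + v * Complex.I) / H))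
    (hM0 : ∀ v : ℝ, M (((γ : ℂ) + H - 1 + v * Complex.I) / H) ≠ 0) {g x : ℝ} (hg : 0 ≤ g)
    (hx : 0 < x) {X : Ω → ℝ} (hX : AEMeasurable X P)
    (hint : Integrable (fun ω => |X ω| ^ ((γ - 1) / H)) P) {m : ℂ → ℂ}
    (hm : ∀ v : ℝ, ∫ ω, ((|X ω| : ℝ) : ℂ) ^ (((γ : ℂ) + H - 1 + v * Complex.I) / H - 1) ∂P =
      m (γ + v * Complex.I) * M (((γ : ℂ) + H - 1 + v * Complex.I) / H)) :
    ∫ ω, estimatorKernel H γ M g x (X ω) ∂P = (1 / (2 * (Real.pi : ℂ))) * ∫ v in (-g)..g,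
      m (γ + v * Complex.I) * (x : ℂ) ^ (-(γ : ℂ) - v * Complex.I) := by
  unfold estimatorKernel
  have hc := continuous_norm_inv hM hM0
  rw [integral_const_mul]
  simp_rw [intervalIntegral.integral_of_le (show -g ≤ g by linarith)]
  rw [integral_integral_swap]
  · congr 2
    ext v
    have h1 : ∀ ω, ((|X ω| : ℝ) : ℂ) ^ (((γ : ℂ) + H - 1 + v * Complex.I) / H - 1) /
        M (((γ : ℂ) + H - 1 + v * Complex.I) / H) * (x : ℂ) ^ (-(γ : ℂ) - v * Complex.I) =
        ((|X ω| : ℝ) : ℂ) ^ (((γ : ℂ) + H - 1 + v * Complex.I) / H - 1) *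
        ((M (((γ : ℂ) + H - 1 + v * Complex.I) / H))⁻¹ *
          (x : ℂ) ^ (-(γ : ℂ) - v * Complex.I)) := fun ω => by ring
    simp_rw [h1]
    rw [integral_mul_const, hm v]
    have := hM0 v
    field_simp
  · have hb : Integrable (fun v : ℝ =>
        ‖(M (((γ : ℂ) + H - 1 + v * Complex.I) / H))⁻¹‖ * x ^ (-γ))
        (volume.restrict (Ioc (-g) g)) :=
      ((hc.mul continuous_const).integrableOn_Icc).mono_set Ioc_subset_Icc_self
    refine Integrable.mono' (hint.mul_prod hb) ?_
      (ae_of_all _ fun q => norm_kernel_integrand_le hH hx (X q.1) q.2)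
    refine ((measurable_kernel_integrand hM x).comp_aemeasurable
      (f := fun q : Ω × ℝ => (X q.1, q.2)) ?_).aestronglyMeasurable
    exact (hX.comp_quasiMeasurePreserving Measure.quasiMeasurePreserving_fst).prodMk
      measurable_snd.aemeasurable

end Kernel

/-! ### Balancing bias and variance -/

section Rates

/-- Merges the two cases: the maximum vanishes for `γ ≥ 1`, and squaring doubles the exponent to `(1
- γ) / H` otherwise. -/
theorem mseBound_eq {H γ β g : ℝ} {n : ℕ} (hH : 0 < H) (hg : 0 < g) :
    mseBound H γ β g n = 1 / n * (g ^ (max 0 ((1 - γ) / (2 * H))) *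
      Real.exp (Real.pi / (4 * H) * g)) ^ 2 + Real.exp (-2 * β * g) := by
  have hexp : Real.exp (Real.pi / (4 * H) * g) ^ 2 = Real.exp (Real.pi * g / (2 * H)) := by
    rw [← Real.exp_nat_mul]
    congr 1
    push_cast
    field_simp
    ring
  unfold mseBound
  rw [mul_pow, hexp]
  split_ifs with h
  · rw [max_eq_left (div_nonpos_of_nonpos_of_nonneg (by linarith) (by positivity)), Real.rpow_zero]
    ring
  · rw [max_eq_right (div_nonneg (by linarith) (by positivity)), ← Real.rpow_natCast,
      ← Real.rpow_mul hg.le]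
    have : (1 - γ) / (2 * H) * (2 : ℕ) = (1 - γ) / H := by
      push_cast
      field_simp
    rw [this]
    ring

theorem tendsto_cutoff {H γ β : ℝ} (hH : 0 < H) (hβ : 0 < β) :
    Tendsto (fun n : ℕ => cutoff H γ β n) atTop atTop := by
  have hD : 0 < Real.pi + 4 * H * β := by positivity
  have hlog : Tendsto (fun n : ℕ => Real.log n) atTop atTop :=
    Real.tendsto_log_atTop.comp tendsto_natCast_atTop_atTop
  unfold cutoff
  split_ifs with h
  · exact (hlog.const_mul_atTop (by positivity : 0 < 2 * H)).atTop_div_const hD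
  · push Not at h
    have hγ : 0 < 2 * (1 - γ) := by linarith
    -- The constant is chosen so that the iterated logarithm takes at most half of the leading term
    -- `2 * H * log n`.
    have hsmall := (Real.isLittleO_log_id_atTop.comp_tendsto hlog).bound
      (show 0 < H / (2 * (1 - γ)) by positivity)
    refine tendsto_atTop_mono' _ ?_ ((hlog.const_mul_atTop hH).atTop_div_const hD)
    filter_upwards [hsmall, hlog.eventually_ge_atTop 0] with n hn hn0
    simp only [Function.comp_apply, id_eq, Real.norm_of_nonneg hn0] at hn
    have h1 := (le_abs_self _).trans hn
    have h2 : 2 * (1 - γ) * Real.log (Real.log n) ≤ H * Real.log n := by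
      calc _ ≤ 2 * (1 - γ) * (H / (2 * (1 - γ)) * Real.log n) := by gcongr
        _ = _ := by field_simp
    gcongr
    linarith

theorem exists_mseBound_cutoff_le {H γ β : ℝ} (hH : 0 < H) (hβ : 0 < β) :
    ∃ C : ℝ, 0 < C ∧ ∀ᶠ n : ℕ in atTop, 0 ≤ rate H γ β n ∧
      mseBound H γ β (cutoff H γ β n) n ≤ C * rate H γ β n ^ 2 := by
  set D := Real.pi + 4 * H * β with hDdef
  have hpi := Real.pi_pos
  have hD : 0 < D := by positivity
  have hlog : Tendsto (fun n : ℕ => Real.log n) atTop atTop :=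
    Real.tendsto_log_atTop.comp tendsto_natCast_atTop_atTop
  rcases le_or_gt 1 γ with h | h
  -- The cut-off makes both terms equal to the squared rate.
  · refine ⟨2, by norm_num, ?_⟩
    filter_upwards [eventually_gt_atTop 0] with n hn
    have hn' : (0 : ℝ) < n := by exact_mod_cast hn
    have hinv : (1 : ℝ) / n = Real.exp (-Real.log n) := by
      rw [Real.exp_neg, Real.exp_log hn', one_div]
    unfold mseBound cutoff rate
    rw [if_pos h, if_pos h, if_pos h, Real.rpow_def_of_pos hn', ← hDdef]
    refine ⟨(Real.exp_pos _).le, le_of_eq ?_⟩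
    have h1 : -Real.log n + Real.pi * (2 * H * Real.log n / D) / (2 * H) =
        (2 : ℕ) * (Real.log n * -(2 * H * β / D)) := by
      push_cast
      field_simp
      rw [hDdef]
      ring
    have h2 : -2 * β * (2 * H * Real.log n / D) = (2 : ℕ) * (Real.log n * -(2 * H * β / D)) := by
      push_cast
      ring
    rw [hinv, ← Real.exp_add, ← Real.exp_nat_mul, h1, h2]
    ring
  · set q := (1 - γ) / H with hq
    have hq0 : 0 < q := div_pos (by linarith) hH
    -- The bias term equals the squared rate. In the variance term `g ^ q` is replaced by `(2 * H /
    -- D * log n) ^ q`, and the iterated logarithm in the cut-off turns the remaining power of `log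
    -- n` into that of the squared rate.
    refine ⟨(2 * H / D) ^ q + 1, by positivity, ?_⟩
    filter_upwards [eventually_gt_atTop 0, hlog.eventually_ge_atTop 1,
      (tendsto_cutoff (γ := γ) hH hβ).eventually_ge_atTop 0] with n hn hL hg
    have hn' : (0 : ℝ) < n := by exact_mod_cast hn
    set L := Real.log n with hLdef
    have hL0 : 0 < L := by linarith
    have hinv : (1 : ℝ) / n = Real.exp (-L) := by
      rw [Real.exp_neg, hLdef, Real.exp_log hn', one_div]
    have hgle : cutoff H γ β n ≤ 2 * H / D * L := by
      unfold cutoff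
      rw [if_neg (not_le.2 h), ← hDdef, ← hLdef, div_mul_eq_mul_div]
      gcongr
      have := mul_nonneg (show 0 ≤ 2 * (1 - γ) by linarith) (Real.log_nonneg hL)
      linarith
    have hcut : cutoff H γ β n = (2 * H * L - 2 * (1 - γ) * Real.log L) / D := by
      unfold cutoff
      rw [if_neg (not_le.2 h)]
    have hrate : rate H γ β n = Real.exp (L * (-(2 * H * β / D))) *
        Real.exp (Real.log L * ((1 - γ) * (2 * β) / D)) := by
      unfold rate
      rw [if_neg (not_le.2 h), Real.rpow_def_of_pos hn', Real.rpow_def_of_pos hL0]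
    set R := Real.exp (L * (-(2 * H * β / D))) *
        Real.exp (Real.log L * ((1 - γ) * (2 * β) / D)) with hR
    have hR2 : R ^ 2 = Real.exp (-(4 * H * β / D) * L + 4 * β * (1 - γ) / D * Real.log L) := by
      rw [hR, ← Real.exp_add, ← Real.exp_nat_mul]
      congr 1
      push_cast
      ring
    rw [hrate]
    refine ⟨by positivity, ?_⟩
    unfold mseBound
    rw [if_neg (not_le.2 h), ← hq, hinv, add_mul, one_mul]
    refine add_le_add ?_ (le_of_eq ?_)
    · calc Real.exp (-L) * cutoff H γ β n ^ q * Real.exp (Real.pi * cutoff H γ β n / (2 * H))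
          ≤ Real.exp (-L) * (2 * H / D * L) ^ q *
              Real.exp (Real.pi * cutoff H γ β n / (2 * H)) := by gcongr
        _ = (2 * H / D) ^ q * R ^ 2 := by
            rw [Real.mul_rpow (by positivity) hL0.le, Real.rpow_def_of_pos hL0, hR2, hcut]
            have : Real.exp (-L) * ((2 * H / D) ^ q * Real.exp (Real.log L * q)) *
                Real.exp (Real.pi * ((2 * H * L - 2 * (1 - γ) * Real.log L) / D) / (2 * H)) =
                (2 * H / D) ^ q * Real.exp (-L + Real.log L * q +
                  Real.pi * ((2 * H * L - 2 * (1 - γ) * Real.log L) / D) / (2 * H)) := by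
              rw [Real.exp_add, Real.exp_add]
              ring
            rw [this]
            congr 2
            rw [hq]
            field_simp
            rw [hDdef]
            ring
    · rw [hR2, hcut]
      congr 1
      field_simp
      ring

end Rates

/-! ### The weighted error bound and the theorem -/

section MeanSquaredError

/-- A non-asymptotic form, with one constant for all `g ≥ 1`, `n ≥ 1` and `x > 0`; both claims of
the theorem specialise it. -/
theorem exists_weighted_mse_le
    {Ω : Type*} [MeasurableSpace Ω] (P : Measure Ω) [IsProbabilityMeasure P]
    {Ω' : Type*} [MeasurableSpace Ω'] (P' : Measure Ω') [IsProbabilityMeasure P']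
    {H : ℝ} (hH : 0 < H) {Y : ℝ≥0 → Ω → ℝ} (hYmeas : ∀ t, Measurable (Y t))
    (hYcadlag : ∀ ω, IsCadlag (fun t => Y t ω)) (hYss : IsSelfSimilar P H Y)
    (hY1 : HasLaw (Y 1) (gaussianReal 0 1) P) {T : Ω → ℝ≥0} (hTmeas : Measurable T)
    (hTY : IndepFun T (fun ω t => Y t ω) P) {fT : ℝ → ℝ} (hfT : HasDensity P T fT)
    {β a b γ : ℝ} (hβ : β ∈ Ioo 0 Real.pi) (hclass : ClassC β a b fT)
    (hγ : γ ∈ Ioo (max a (1 - H / 2)) b) (hγ' : 2 * γ - 1 ∈ Ioo a b)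
    {X : ℕ → Ω' → ℝ} (hXindep : iIndepFun X P')
    (hXlaw : ∀ k, IdentDistrib (X k) (fun ω => Y (T ω) ω) P' P) :
    ∃ C : ℝ, 0 < C ∧ ∀ g : ℝ, 1 ≤ g → ∀ n : ℕ, 0 < n → ∀ x : ℝ, 0 < x →
      ENNReal.ofReal (x ^ (2 * γ)) *
          mse P' (fT x)
            (fun ω => estimator H γ (absMellin P (Y 1)) g n (fun k => X k ω) x) ≤
        ENNReal.ofReal (C * mseBound H γ β g n) := by
  have haγ : a < γ := (le_max_left _ _).trans_lt hγ.1
  have hHγ : 1 - H / 2 < γ := (le_max_right _ _).trans_lt hγ.1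
  have hγH : 0 < γ + H - 1 := by linarith
  have hγab : γ ∈ Ioo a b := ⟨haγ, hγ.2⟩
  have hmeas := hclass.aemeasurable hβ.1.le
  have hlaw : ∀ k, P'.map (X k) =
      ((P.map T).prod (P.map (Y 1))).map (fun q => (q.1 : ℝ) ^ H * q.2) := fun k => by
    rw [(hXlaw k).map_eq, map_timeChange hH hYss hYmeas hYcadlag hTmeas hTY]
  have hXm : ∀ k, AEMeasurable (X k) P' := fun k => (hXlaw k).aemeasurable_fst
  set M := absMellin P (Y 1) with hMdef
  have hM := continuous_absMellin_line hY1 hH hγH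
  have hM0 := absMellin_line_ne_zero hY1 hH hγH
  rw [← hMdef] at hM hM0
  obtain ⟨CB, hCB, hbias⟩ := exists_norm_sub_truncated_mellinInv_le hβ hclass hγab
  obtain ⟨CJ, hCJ, hJ⟩ := exists_integral_norm_inv_absMellin_le hY1 hH hγH
  rw [← hMdef] at hJ
  have hmom : ∀ k, Integrable (fun ω => |X k ω| ^ ((γ - 1) / H)) P' := fun k => by
    refine integrable_abs_rpow_of_map_eq hTmeas hY1 hfT hmeas (hXm k) (hlaw k) hclass.1 ?_ ?_
    · rwa [mul_div_cancel₀ _ hH.ne', sub_add_cancel]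
    · rw [lt_div_iff₀ hH]
      linarith
  -- For the order `p = 2 (γ - 1) / H` one has `H p + 1 = 2γ - 1`, the hypothesis on `T`, while `p >
  -- -1`, needed for the Gaussian factor, is `γ > 1 - H / 2`.
  have hmom2 : ∀ k, Integrable (fun ω => |X k ω| ^ (2 * (γ - 1) / H)) P' := fun k => by
    refine integrable_abs_rpow_of_map_eq hTmeas hY1 hfT hmeas (hXm k) (hlaw k) hclass.1 ?_ ?_
    · rw [mul_div_cancel₀ _ hH.ne']
      convert hγ' using 1
      ring
    · rw [lt_div_iff₀ hH]
      linarith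
  have hcmom : ∀ k, ∀ v : ℝ,
      ∫ ω, ((|X k ω| : ℝ) : ℂ) ^ (((γ : ℂ) + H - 1 + v * Complex.I) / H - 1) ∂P' =
      mellin (fun x => (fT x : ℂ)) (γ + v * Complex.I) *
        M (((γ : ℂ) + H - 1 + v * Complex.I) / H) := fun k v => by
    have hHc : (H : ℂ) ≠ 0 := by exact_mod_cast hH.ne'
    rw [integral_abs_cpow_of_map_eq hH hTmeas (hYmeas 1) hfT hmeas (hXm k) (hlaw k),
      sub_add_cancel]
    congr 2
    field_simp
    ring
  set V₀ := ∫ ω, |X 0 ω| ^ (2 * (γ - 1) / H) ∂P' with hV₀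
  have hV₀0 : 0 ≤ V₀ := integral_nonneg fun ω => by positivity
  have hV₀k : ∀ k, ∫ ω, |X k ω| ^ (2 * (γ - 1) / H) ∂P' = V₀ := fun k => by
    have hm : Measurable fun y : ℝ => |y| ^ (2 * (γ - 1) / H) := by fun_prop
    rw [hV₀, ← integral_map (f := fun y : ℝ => |y| ^ (2 * (γ - 1) / H)) (hXm k)
      hm.aestronglyMeasurable, hlaw k, ← hlaw 0, integral_map (hXm 0) hm.aestronglyMeasurable]
  refine ⟨2 * CB ^ 2 + 4 * CJ ^ 2 * V₀, by positivity, fun g hg n hn x hx => ?_⟩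
  have hg0 : 0 ≤ g := by linarith
  have hn' : (0 : ℝ) < n := by exact_mod_cast hn
  set J := ∫ v in (-g)..g, ‖(M (((γ : ℂ) + H - 1 + v * Complex.I) / H))⁻¹‖ with hJdef
  have hJ0 : 0 ≤ J := intervalIntegral.integral_nonneg (by linarith) fun v _ => norm_nonneg _
  set φ := estimatorKernel H γ M g x with hφ
  have hφm : Measurable φ := measurable_estimatorKernel hM hg0 x
  have hφsq : ∀ y, ‖φ y‖ ^ 2 ≤ (x ^ (-γ) * J) ^ 2 * |y| ^ (2 * (γ - 1) / H) := fun y => by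
    have h1 := norm_estimatorKernel_le hH hM hM0 hg0 hx y
    have h2 : |y| ^ (2 * (γ - 1) / H) = (|y| ^ ((γ - 1) / H)) ^ 2 := by
      rw [← Real.rpow_natCast, ← Real.rpow_mul (abs_nonneg y)]
      congr 1
      push_cast
      ring
    rw [h2, ← mul_pow]
    refine pow_le_pow_left₀ (norm_nonneg _) (h1.trans_eq ?_) 2
    ring
  have hφmeas : ∀ k, AEStronglyMeasurable (fun ω => φ (X k ω)) P' := fun k =>
    (hφm.comp_aemeasurable (hXm k)).aestronglyMeasurable
  have hφsqint : ∀ k, Integrable (fun ω => ‖φ (X k ω)‖ ^ 2) P' := fun k => by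
    refine Integrable.mono' ((hmom2 k).const_mul ((x ^ (-γ) * J) ^ 2)) ((hφmeas k).norm.pow 2)
      (ae_of_all _ fun ω => ?_)
    rw [Real.norm_of_nonneg (by positivity)]
    exact hφsq _
  have hmse := mse_sampleMean_le (P := P') (Z := fun k ω => φ (X k ω))
    (m := (1 / (2 * (Real.pi : ℂ))) * ∫ v in (-g)..g,
      mellin (fun x => (fT x : ℂ)) (γ + v * Complex.I) * (x : ℂ) ^ (-(γ : ℂ) - v * Complex.I))
    (V := (x ^ (-γ) * J) ^ 2 * V₀)
    (fun k => (memLp_two_iff_integrable_sq_norm (hφmeas k)).2 (hφsqint k))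
    (hXindep.comp (fun _ => φ) fun _ => hφm)
    (fun k => integral_estimatorKernel hH hM hM0 hg0 hx (hXm k) (hmom k) (hcmom k))
    (fun k => by
      refine (integral_mono (hφsqint k) ((hmom2 k).const_mul _) fun ω => hφsq _).trans_eq ?_
      rw [integral_const_mul, hV₀k k]) hn (fT x)
  simp_rw [estimator_eq_sum_kernel hH hM hM0 hx]
  -- The weight cancels the `x ^ (-γ)` common to bias and standard deviation, which makes the bound
  -- uniform in `x`.
  have hxx : x ^ (2 * γ) * (x ^ (-γ)) ^ 2 = 1 := by
    rw [← Real.rpow_natCast, ← Real.rpow_mul hx.le, ← Real.rpow_add hx]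
    convert Real.rpow_zero x using 2
    push_cast
    ring
  have hexp : Real.exp (-β * g) ^ 2 = Real.exp (-2 * β * g) := by
    rw [← Real.exp_nat_mul]
    congr 1
    push_cast
    ring
  refine (mul_le_mul_right hmse _).trans ?_
  rw [← ENNReal.ofReal_mul (by positivity)]
  refine ENNReal.ofReal_le_ofReal ?_
  rw [mseBound_eq hH (by linarith)]
  have hb := hbias g hg0 x hx
  have hJb := hJ g hg
  rw [mul_assoc] at hJb
  set E := g ^ (max 0 ((1 - γ) / (2 * H))) * Real.exp (Real.pi / (4 * H) * g) with hE
  calc _ ≤ x ^ (2 * γ) * (2 * (CB * x ^ (-γ) * Real.exp (-β * g)) ^ 2 +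
        4 * ((x ^ (-γ) * (CJ * E)) ^ 2 * V₀ / n)) := by gcongr
    _ = x ^ (2 * γ) * (x ^ (-γ)) ^ 2 * (2 * CB ^ 2 * Real.exp (-β * g) ^ 2 +
        4 * CJ ^ 2 * V₀ * (1 / n * E ^ 2)) := by ring
    _ = 2 * CB ^ 2 * Real.exp (-2 * β * g) + 4 * CJ ^ 2 * V₀ * (1 / n * E ^ 2) := by
        rw [hxx, hexp, one_mul]
    _ ≤ _ := by
        have h1 : 0 ≤ CB ^ 2 * (1 / n * E ^ 2) := by positivity
        have h2 : 0 ≤ CJ ^ 2 * V₀ * Real.exp (-2 * β * g) := by positivity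
        linarith

end MeanSquaredError

theorem theorem12
    {Ω : Type*} [MeasurableSpace Ω] (P : Measure Ω) [IsProbabilityMeasure P]
    {Ω' : Type*} [MeasurableSpace Ω'] (P' : Measure Ω') [IsProbabilityMeasure P']
    (H : ℝ) (hH : 0 < H)
    -- the process
    (Y : ℝ≥0 → Ω → ℝ) (hYmeas : ∀ t, Measurable (Y t))
    (hYcadlag : ∀ ω, IsCadlag (fun t => Y t ω))
    (hYss : IsSelfSimilar P H Y)
    (hY1 : HasLaw (Y 1) (gaussianReal 0 1) P)
    -- the random time
    (T : Ω → ℝ≥0) (hTmeas : Measurable T)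
    (hTY : IndepFun T (fun ω t => Y t ω) P)
    (fT : ℝ → ℝ) (hfT : HasDensity P T fT)
    (β a b γ : ℝ) (hβ : β ∈ Ioo 0 Real.pi) (ha : 0 ≤ a) (hab : a < b)
    (hclass : ClassC β a b fT)
    (hγ : γ ∈ Ioo (max a (1 - H / 2)) b) (hγ' : 2 * γ - 1 ∈ Ioo a b)
    -- the i.i.d. observations of `Y_T`
    (X : ℕ → Ω' → ℝ) (hXindep : iIndepFun X P')
    (hXlaw : ∀ k, IdentDistrib (X k) (fun ω => Y (T ω) ω) P' P) :
    (∃ C : ℝ, 0 < C ∧ ∀ g : ℕ → ℝ, Tendsto g atTop atTop →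
      ∀ᶠ n : ℕ in atTop, ∀ x : ℝ, 0 < x →
        ENNReal.ofReal (x ^ (2 * γ)) *
            mse P' (fT x)
              (fun ω => estimator H γ (absMellin P (Y 1)) (g n) n (fun k => X k ω) x) ≤
          ENNReal.ofReal (C * mseBound H γ β (g n) n)) ∧
    (∃ C : ℝ, 0 < C ∧ ∀ᶠ n : ℕ in atTop,
      ⨆ (x : ℝ) (_ : 0 < x),
        ENNReal.ofReal (x ^ γ) *
            (mse P' (fT x)
              (fun ω => estimator H γ (absMellin P (Y 1)) (cutoff H γ β n) n
                (fun k => X k ω) x)) ^ (1 / 2 : ℝ) ≤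
          ENNReal.ofReal (C * rate H γ β n)) := by
  obtain ⟨C, hC, hmain⟩ := exists_weighted_mse_le P P' hH hYmeas hYcadlag hYss hY1 hTmeas hTY hfT hβ
    hclass hγ hγ' hXindep hXlaw
  refine ⟨⟨C, hC, fun g hg => ?_⟩, ?_⟩
  · filter_upwards [hg.eventually_ge_atTop 1, eventually_gt_atTop 0] with n hgn hn x hx
    exact hmain (g n) hgn n hn x hx
  · obtain ⟨K, hK, hrate⟩ := exists_mseBound_cutoff_le (γ := γ) hH hβ.1
    -- `C` comes from the error bound and `K` from the balance against the squared rate; the root is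
    -- taken at the end.
    refine ⟨√(C * K), by positivity, ?_⟩
    filter_upwards [(tendsto_cutoff (γ := γ) hH hβ.1).eventually_ge_atTop 1, eventually_gt_atTop 0,
      hrate] with n hgn hn hr
    refine iSup₂_le fun x hx => ?_
    have h1 := hmain _ hgn n hn x hx
    have h2 : ENNReal.ofReal (x ^ γ) = ENNReal.ofReal (x ^ (2 * γ)) ^ (1 / 2 : ℝ) := by
      rw [ENNReal.ofReal_rpow_of_nonneg (by positivity) (by norm_num), ← Real.rpow_mul hx.le]
      congr 2
      ring
    rw [h2, ← ENNReal.mul_rpow_of_nonneg _ _ (by norm_num)]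
    calc _ ≤ ENNReal.ofReal (C * mseBound H γ β (cutoff H γ β n) n) ^ (1 / 2 : ℝ) := by gcongr
      _ ≤ ENNReal.ofReal (C * K * rate H γ β n ^ 2) ^ (1 / 2 : ℝ) := by
          refine ENNReal.rpow_le_rpow (ENNReal.ofReal_le_ofReal ?_) (by norm_num)
          rw [mul_assoc]
          exact mul_le_mul_of_nonneg_left hr.2 hC.le
      _ = ENNReal.ofReal (√(C * K) * rate H γ β n) := by
          rw [ENNReal.ofReal_rpow_of_nonneg (by positivity) (by norm_num), ← Real.sqrt_eq_rpow,
            Real.sqrt_mul (by positivity), Real.sqrt_sq hr.1]
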